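/- Let $\mathbb K$ be $\mathbb R$ or $\mathbb C$. For Banach spaces $X_1,\dots,X_n$ ($n\ge 1$) a reasonable crossnorm $\beta$ is a norm on $X_1\otimes\cdots\otimes X_n$ with $\varepsilon\le\beta\le\pi$ (injective and projective tensor norms); $\Sigma_X$ is the set of decomposable tensors, and $\mathcal L^\beta(X_1,\dots,X_n):=(X_1\otimes\cdots\otimes X_n,\beta)^*$ with norm $\|\cdot\|_\beta$. An election $(n,X_1,\dots,X_n,Y,\beta)$ consists of $n\geq 1$, Banach spaces $X_i,Y$ and a reasonable crossnorm $\beta$. For subspaces $E_i\subset X_i$, $\beta|$ is the restriction of $\beta$ to $E_1\otimes\cdots\otimes E_n$. $\mathcal F(V)$ denotes the finite dimensional subspaces of $V$ and $\mathcal{CF}(V)$ the closed finite codimensional ones; $Q_L:Y\to Y/L$ is the quotient map. For a bounded multilinear operator $T$, $\tilde T$ is its linearization and $f_T=\tilde T|_{\Sigma_X}$. For $\varphi\in\mathcal L^\beta(X_1,\dots,X_n)$ and $y\in Y$, $\varphi\cdot y$ is the operator $(x_1,\dots,x_n)\mapsto\varphi(x_1\otimes\cdots\otimes x_n)\,y$.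 A $\Sigma$-tensor norm on duals $\nu$ assigns to each election a norm $\nu_\beta$ on $\mathcal L^\beta(X_1,\dots,X_n)\otimes Y$ such that: (D1) $\nu_\beta(\varphi\otimes y)\le\|\varphi\|_\beta\|y\|$; (D2) for $p,q\in\Sigma_X$ and $y^*\in Y^*$ the functional $\varphi\otimes y\mapsto(\varphi(p)-\varphi(q))y^*(y)$ has norm at most $\beta(p-q)\|y^*\|$; (D3) $\|A\otimes B\|\le\|A\|\|B\|$ (with respect to $\nu_\beta$ and $\nu_\theta$) for all bounded linear $B:Y\to W$ and $A:\mathcal L^\beta(X_1,\dots,X_n)\to\mathcal L^\theta(Z_1,\dots,Z_m)$ such that $A^*$ maps the canonical image of $\Sigma_Z$ in the bidual of $(Z_1\otimes\cdots\otimes Z_m,\theta)$ into that of $\Sigma_X$ in the bidual of $(X_1\otimes\cdots\otimes X_n,\beta)$. A $\Sigma$-ideal $[\mathcal A,A]$ assigns to each election a linear subspace $\mathcal A^\beta(X_1,\dots,X_n;Y)$ of $\mathcal L(X_1,\dots,X_n;Y)$ (the bounded multilinear operators) and a complete norm $A^\beta$ on it such that: (I1) $\varphi\cdot y\in\mathcal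 A^\beta(X_1,\dots,X_n;Y)$ and $A^\beta(\varphi\cdot y)\le\|\varphi\|_\beta\|y\|$ for $\varphi\in\mathcal L^\beta(X_1,\dots,X_n)$, $y\in Y$; (I2) $\|f_T(p)-f_T(q)\|\le A^\beta(T)\,\beta(p-q)$ for $T\in\mathcal A^\beta(X_1,\dots,X_n;Y)$ and $p,q\in\Sigma_X$; (I3) if $\tilde R:(Z_1\otimes\cdots\otimes Z_m,\theta)\to(X_1\otimes\cdots\otimes X_n,\beta)$ is bounded linear with $\tilde R(\Sigma_Z)\subset\Sigma_X$, $T\in\mathcal A^\beta(X_1,\dots,X_n;Y)$ and $S:Y\to W$ is bounded linear, then $U:(z_1,\dots,z_m)\mapsto S f_T(\tilde R(z_1\otimes\cdots\otimes z_m))$ is in $\mathcal A^\theta(Z_1,\dots,Z_m;W)$ and $A^\theta(U)\le\|\tilde R\|A^\beta(T)\|S\|$. It is maximal if it coincides with its maximal hull: for every election and every $T\in\mathcal L(X_1,\dots,X_n;Y)$, $T\in\mathcal A^\beta(X_1,\dots,X_n;Y)$ if and only if $$s(T):=\sup\{A^{\beta|}(Q_L\,T|_{E_1\times\cdots\times E_n})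 : E_i\in\mathcal F(X_i),\ L\in\mathcal{CF}(Y)\}<\infty,$$ and then $A^\beta(T)=s(T)$. It is associated to $\nu$ if for all elections of finite dimensional spaces $\varphi\otimes y\mapsto\varphi\cdot y$ is an isometric isomorphism of $(\mathcal L^\beta(E_1,\dots,E_n)\otimes F,\nu_\beta)$ onto $\mathcal A^\beta(E_1,\dots,E_n;F)$. The finitely generated $\Sigma$-tensor norm on spaces $\alpha$ defined by $\nu$ is given as follows. For finite dimensional spaces, $\alpha^\beta$ on $E_1\otimes\cdots\otimes E_n\otimes F$ is the norm of the dual $(\mathcal L^\beta(E_1,\dots,E_n)\otimes F^*,\nu_\beta)^*$, tensors acting by evaluation. In general $\alpha^\beta(u;X_1,\dots,X_n,Y)$ is the infimum of $\alpha^{\beta|}(u;E_1,\dots,E_n,F)$ over all $E_i\in\mathcal F(X_i)$, $F\in\mathcal F(Y)$ with $u\in E_1\otimes\cdots\otimes E_n\otimes F$. **Theorem (Representation Theorem for Maximal $\Sigma$-ideals).** Let $\nu$ be a $\Sigma$-tensor norm on duals, $[\mathcal A,A]$ the maximal $\Sigma$-ideal associated to $\nu$, and $\alpha$ the finitely generated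 $\Sigma$-tensor norm on spaces defined by $\nu$. Then for every election $(n,X_1,\dots,X_n,Y,\beta)$ of Banach spaces $$(X_1\otimes\cdots\otimes X_n\otimes Y,\alpha^\beta)^*=\mathcal A^\beta(X_1,\dots,X_n;Y^*)$$ holds linearly and isometrically, where $\phi$ corresponds to the operator $T_\phi$ with $T_\phi(x_1,\dots,x_n)(y)=\phi(x_1\otimes\cdots\otimes x_n\otimes y)$. Also $$(X_1\otimes\cdots\otimes X_n\otimes Y^*,\alpha^\beta)^*\cap\mathcal L(X_1,\dots,X_n;Y)=\mathcal A^\beta(X_1,\dots,X_n;Y)$$ holds linearly and isometrically. Here the left-hand side consists of the bounded functionals $\phi$ for which there is $T\in\mathcal L(X_1,\dots,X_n;Y)$ with $\phi(x_1\otimes\cdots\otimes x_n\otimes y^*)=y^*(T(x_1,\dots,x_n))$, carries the norm of the dual, and $\phi$ corresponds to $T$. -/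

import Mathlib

open scoped TensorProduct ENNReal

universe u

noncomputable section

namespace SigmaIdeals

/-! ### Reasonable crossnorms and the normed space `(X₁ ⊗ ⋯ ⊗ Xₙ, β)` -/

section Crossnorm

variable (𝕜 : Type) [RCLike 𝕜] {n : ℕ} (X : Fin n → Type u)
  [∀ i, NormedAddCommGroup (X i)] [∀ i, NormedSpace 𝕜 (X i)]

/-- The linear form `x₁* ⊗ ⋯ ⊗ xₙ*` on `X₁ ⊗ ⋯ ⊗ Xₙ`. -/
def tensorForm (f : ∀ i, StrongDual 𝕜 (X i)) : (⨂[𝕜] i, X i) →ₗ[𝕜] 𝕜 :=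
  PiTensorProduct.lift
    ((MultilinearMap.mkPiAlgebra 𝕜 (Fin n) 𝕜).compLinearMap fun i => (f i : X i →ₗ[𝕜] 𝕜))

/-- A reasonable crossnorm: a norm `β` on `X₁ ⊗ ⋯ ⊗ Xₙ` with `ε ≤ β ≤ π`, where `π` is the
projective norm and `ε u` is the supremum of `|x₁* ⊗ ⋯ ⊗ xₙ* (u)|` over functionals `xᵢ*` in the
dual unit balls. -/
structure ReasonableCrossnorm where
  /-- the norm -/
  toSeminorm : Seminorm 𝕜 (⨂[𝕜] i, X i)
  eq_zero : ∀ u, toSeminorm u = 0 → u = 0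
  injective_le : ∀ f : ∀ i, StrongDual 𝕜 (X i), (∀ i, ‖f i‖ ≤ 1) →
    ∀ u, ‖tensorForm 𝕜 X f u‖ ≤ toSeminorm u
  le_projective : ∀ u, toSeminorm u ≤ PiTensorProduct.projectiveSeminorm u

variable {𝕜 X}

/-- The algebraic tensor product `X₁ ⊗ ⋯ ⊗ Xₙ`, to be endowed with the norm `β`. -/
def CrossTensor (_β : ReasonableCrossnorm 𝕜 X) : Type u := ⨂[𝕜] i, X i

instance (β : ReasonableCrossnorm 𝕜 X) : AddCommGroup (CrossTensor β) :=
  inferInstanceAs (AddCommGroup (⨂[𝕜] i, X i))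

instance (β : ReasonableCrossnorm 𝕜 X) : Module 𝕜 (CrossTensor β) :=
  inferInstanceAs (Module 𝕜 (⨂[𝕜] i, X i))

instance (β : ReasonableCrossnorm 𝕜 X) : Norm (CrossTensor β) := ⟨fun u => β.toSeminorm u⟩

theorem crossTensor_core (β : ReasonableCrossnorm 𝕜 X) :
    NormedSpace.Core 𝕜 (CrossTensor β) where
  norm_nonneg u := apply_nonneg β.toSeminorm u
  norm_smul c u := map_smul_eq_mul β.toSeminorm c u
  norm_triangle u v := map_add_le_add β.toSeminorm u v
  norm_eq_zero_iff u := ⟨β.eq_zero u, fun h => by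
    rw [h]; exact map_zero β.toSeminorm⟩

instance (β : ReasonableCrossnorm 𝕜 X) : NormedAddCommGroup (CrossTensor β) :=
  NormedAddCommGroup.ofCore (crossTensor_core β)

instance (β : ReasonableCrossnorm 𝕜 X) : NormedSpace 𝕜 (CrossTensor β) :=
  NormedSpace.ofCore (crossTensor_core β)

/-- The decomposable tensor `x₁ ⊗ ⋯ ⊗ xₙ`, as a bounded multilinear map into
`(X₁ ⊗ ⋯ ⊗ Xₙ, β)`. -/
def tensor (β : ReasonableCrossnorm 𝕜 X) : ContinuousMultilinearMap 𝕜 X (CrossTensor β) :=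
  MultilinearMap.mkContinuous (G := CrossTensor β)
    (PiTensorProduct.tprod 𝕜 : MultilinearMap 𝕜 X (⨂[𝕜] i, X i)) 1 fun x => by
      rw [one_mul]
      exact (β.le_projective _).trans (PiTensorProduct.projectiveSeminorm_tprod_le x)

/-- The set `Σ` of decomposable tensors (the Segre cone). -/
def segre (β : ReasonableCrossnorm 𝕜 X) : Set (CrossTensor β) := Set.range (tensor β)

/-- `ℒ^β(X₁, …, Xₙ)`: the bounded linear forms on `(X₁ ⊗ ⋯ ⊗ Xₙ, β)`, which are the
linearizations of the multilinear forms `φ` with `‖φ‖_β < ∞`, normed by `‖φ‖_β`. -/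
abbrev Forms (β : ReasonableCrossnorm 𝕜 X) : Type u := StrongDual 𝕜 (CrossTensor β)

/-- The linearization of a multilinear operator; its restriction to the decomposable tensors is
the associated `Σ`-operator `f_T`. -/
def linearization (β : ReasonableCrossnorm 𝕜 X) {Y : Type u} [NormedAddCommGroup Y]
    [NormedSpace 𝕜 Y] (T : ContinuousMultilinearMap 𝕜 X Y) : CrossTensor β →ₗ[𝕜] Y :=
  (PiTensorProduct.lift T.toMultilinearMap : (⨂[𝕜] i, X i) →ₗ[𝕜] Y)

/-- The rank-one operator `φ · y`, `(x₁, …, xₙ) ↦ φ (x₁ ⊗ ⋯ ⊗ xₙ) y`. -/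
def rankOne (β : ReasonableCrossnorm 𝕜 X) {Y : Type u} [NormedAddCommGroup Y]
    [NormedSpace 𝕜 Y] (φ : Forms β) (y : Y) : ContinuousMultilinearMap 𝕜 X Y :=
  (φ.smulRight y).compContinuousMultilinearMap (tensor β)

/-- The linear map `ℒ^β(X₁, …, Xₙ) ⊗ Y → ℒ(X₁, …, Xₙ; Y)`, `φ ⊗ y ↦ φ · y`. -/
def toOperator (β : ReasonableCrossnorm 𝕜 X) (Y : Type u) [NormedAddCommGroup Y]
    [NormedSpace 𝕜 Y] : Forms β ⊗[𝕜] Y →ₗ[𝕜] ContinuousMultilinearMap 𝕜 X Y :=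
  TensorProduct.lift (LinearMap.mk₂ 𝕜 (rankOne β)
    (fun φ ψ y => by ext x; simp [rankOne, add_smul])
    (fun c φ y => by ext x; simp [rankOne, mul_smul])
    (fun φ y z => by ext x; simp [rankOne])
    (fun c φ y => by
      ext x
      simpa [rankOne] using smul_comm (φ (tensor β x)) c y))

/-- `R` is (the linearization of) a `Σ`-`β`-`θ`-operator: the multilinear operator
`(z₁, …, zₘ) ↦ R (z₁ ⊗ ⋯ ⊗ zₘ)` takes decomposable values. -/
def IsSigmaOperator {m : ℕ} {Z : Fin m → Type u} [∀ i, NormedAddCommGroup (Z i)]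
    [∀ i, NormedSpace 𝕜 (Z i)] {θ : ReasonableCrossnorm 𝕜 Z} {β : ReasonableCrossnorm 𝕜 X}
    (R : CrossTensor θ →L[𝕜] CrossTensor β) : Prop :=
  ∀ q ∈ segre θ, R q ∈ segre β

/-- `A : ℒ^β(X₁, …, Xₙ) → ℒ^θ(Z₁, …, Zₘ)` preserves `Σ`: its adjoint maps (the canonical image in
the bidual of) decomposable tensors to (canonical images of) decomposable tensors. -/
def PreservesSigma {m : ℕ} {Z : Fin m → Type u} [∀ i, NormedAddCommGroup (Z i)]
    [∀ i, NormedSpace 𝕜 (Z i)] {θ : ReasonableCrossnorm 𝕜 Z} {β : ReasonableCrossnorm 𝕜 X}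
    (A : Forms β →L[𝕜] Forms θ) : Prop :=
  ∀ q ∈ segre θ, ∃ p ∈ segre β,
    (NormedSpace.inclusionInDoubleDual 𝕜 (CrossTensor θ) q).comp A =
      NormedSpace.inclusionInDoubleDual 𝕜 (CrossTensor β) p

/-- For `v ∈ ℒ^β(X₁, …, Xₙ) ⊗ Y*`, the functional on `X₁ ⊗ ⋯ ⊗ Xₙ ⊗ Y` with
`φ ⊗ y* ↦ (w ⊗ y ↦ φ(w) y*(y))`. -/
def evaluation (β : ReasonableCrossnorm 𝕜 X) (Y : Type u) [NormedAddCommGroup Y]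
    [NormedSpace 𝕜 Y] :
    Forms β ⊗[𝕜] StrongDual 𝕜 Y →ₗ[𝕜] Module.Dual 𝕜 (CrossTensor β ⊗[𝕜] Y) :=
  TensorProduct.dualDistrib 𝕜 (CrossTensor β) Y ∘ₗ
    TensorProduct.map (ContinuousLinearMap.coeLM 𝕜) (ContinuousLinearMap.coeLM 𝕜)

/-- For `w ∈ X₁ ⊗ ⋯ ⊗ Xₙ` and `y* ∈ Y*`, the functional `w ⊗ y*` on `ℒ^β(X₁, …, Xₙ) ⊗ Y` with
`φ ⊗ y ↦ φ(w) y*(y)`. -/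
def evaluationAt {β : ReasonableCrossnorm 𝕜 X} {Y : Type u} [NormedAddCommGroup Y]
    [NormedSpace 𝕜 Y] (w : CrossTensor β) (g : StrongDual 𝕜 Y) :
    Module.Dual 𝕜 (Forms β ⊗[𝕜] Y) :=
  TensorProduct.dualDistrib 𝕜 (Forms β) Y
    ((NormedSpace.inclusionInDoubleDual 𝕜 (CrossTensor β) w : Forms β →ₗ[𝕜] 𝕜) ⊗ₜ[𝕜]
      (g : Y →ₗ[𝕜] 𝕜))

end Crossnorm

/-! ### Finite dimensional and finite codimensional subspaces -/

section Local

variable (𝕜 : Type) [RCLike 𝕜]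

/-- `ℱ(V)`: the finite dimensional subspaces of `V`. -/
def FinSub (V : Type u) [NormedAddCommGroup V] [NormedSpace 𝕜 V] : Type u :=
  {E : Submodule 𝕜 V // FiniteDimensional 𝕜 E}

/-- `𝒞ℱ(V)`: the closed subspaces of `V` of finite codimension. -/
def CofinSub (V : Type u) [NormedAddCommGroup V] [NormedSpace 𝕜 V] : Type u :=
  {L : Submodule 𝕜 V // IsClosed (L : Set V) ∧ FiniteDimensional 𝕜 (V ⧸ L)}

variable {𝕜}

instance {V : Type u} [NormedAddCommGroup V] [NormedSpace 𝕜 V] (E : FinSub 𝕜 V) :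
    FiniteDimensional 𝕜 E.1 := E.2

instance {V : Type u} [NormedAddCommGroup V] [NormedSpace 𝕜 V] (E : FinSub 𝕜 V) :
    CompleteSpace E.1 := FiniteDimensional.complete 𝕜 E.1

instance {V : Type u} [NormedAddCommGroup V] [NormedSpace 𝕜 V] (L : CofinSub 𝕜 V) :
    IsClosed (L.1 : Set V) := L.2.1

variable {n : ℕ} {X : Fin n → Type u} [∀ i, NormedAddCommGroup (X i)]
  [∀ i, NormedSpace 𝕜 (X i)]

/-- The inclusion `E₁ ⊗ ⋯ ⊗ Eₙ → X₁ ⊗ ⋯ ⊗ Xₙ`. -/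
def tensorIncl (E : ∀ i, FinSub 𝕜 (X i)) : (⨂[𝕜] i, (E i).1) →ₗ[𝕜] ⨂[𝕜] i, X i :=
  PiTensorProduct.map fun i => (E i).1.subtype

theorem tensorIncl_injective (E : ∀ i, FinSub 𝕜 (X i)) :
    Function.Injective (tensorIncl E) := by
  have h : ∀ i, ∃ g : X i →ₗ[𝕜] (E i).1, g ∘ₗ (E i).1.subtype = LinearMap.id := fun i =>
    LinearMap.exists_leftInverse_of_injective _ (Submodule.ker_subtype _)
  choose g hg using h
  have hc : PiTensorProduct.map g ∘ₗ tensorIncl E = LinearMap.id := by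
    rw [tensorIncl, ← PiTensorProduct.map_comp]
    simp only [hg]
    exact PiTensorProduct.map_id
  intro a b hab
  have := congrArg (PiTensorProduct.map g) hab
  rwa [← LinearMap.comp_apply, ← LinearMap.comp_apply, hc] at this

theorem tensorForm_tensorIncl (E : ∀ i, FinSub 𝕜 (X i)) (f : ∀ i, StrongDual 𝕜 (E i).1)
    (g : ∀ i, StrongDual 𝕜 (X i)) (h : ∀ i, ∀ x : (E i).1, g i x = f i x)
    (u : ⨂[𝕜] i, (E i).1) :
    tensorForm 𝕜 X g (tensorIncl E u) = tensorForm 𝕜 (fun i => (E i).1) f u := by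
  have : tensorForm 𝕜 X g ∘ₗ tensorIncl E = tensorForm 𝕜 (fun i => (E i).1) f := by
    apply PiTensorProduct.ext
    ext x
    simp [tensorForm, tensorIncl, h]
  exact LinearMap.congr_fun this u

theorem projective_tensorIncl_le (E : ∀ i, FinSub 𝕜 (X i)) (u : ⨂[𝕜] i, (E i).1) :
    PiTensorProduct.projectiveSeminorm (tensorIncl E u) ≤
      PiTensorProduct.projectiveSeminorm u := by
  let f : ∀ i, (E i).1 →L[𝕜] X i := fun i => (E i).1.subtypeL
  have h : ∏ i, ‖f i‖ ≤ 1 :=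
    Finset.prod_le_one (fun i _ => norm_nonneg _) fun i _ => Submodule.norm_subtypeL_le _
  have k := (PiTensorProduct.mapL f).le_of_opNorm_le ((PiTensorProduct.opNorm_mapL f).trans h) u
  rw [one_mul] at k
  exact k

/-- The restriction `β|` of a reasonable crossnorm to `E₁ ⊗ ⋯ ⊗ Eₙ`. -/
def ReasonableCrossnorm.restrict (β : ReasonableCrossnorm 𝕜 X) (E : ∀ i, FinSub 𝕜 (X i)) :
    ReasonableCrossnorm 𝕜 (fun i => (E i).1) where
  toSeminorm := β.toSeminorm.comp (tensorIncl E)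
  eq_zero u hu := tensorIncl_injective E <| by
    rw [map_zero]; exact β.eq_zero _ hu
  injective_le f hf u := by
    choose g hg hgn using fun i => exists_extension_norm_eq (E i).1 (f i)
    rw [← tensorForm_tensorIncl E f g hg u]
    exact β.injective_le g (fun i => (hgn i).le.trans (hf i)) _
  le_projective u := (β.le_projective _).trans (projective_tensorIncl_le E u)

/-- The inclusion `(E₁ ⊗ ⋯ ⊗ Eₙ, β|) → (X₁ ⊗ ⋯ ⊗ Xₙ, β)`. -/
def crossIncl (β : ReasonableCrossnorm 𝕜 X) (E : ∀ i, FinSub 𝕜 (X i)) :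
    CrossTensor (β.restrict E) →ₗ[𝕜] CrossTensor β :=
  tensorIncl E

/-- The inclusion `E₁ ⊗ ⋯ ⊗ Eₙ ⊗ F → X₁ ⊗ ⋯ ⊗ Xₙ ⊗ Y`. -/
def incl (β : ReasonableCrossnorm 𝕜 X) {Y : Type u} [NormedAddCommGroup Y] [NormedSpace 𝕜 Y]
    (E : ∀ i, FinSub 𝕜 (X i)) (F : FinSub 𝕜 Y) :
    CrossTensor (β.restrict E) ⊗[𝕜] F.1 →ₗ[𝕜] CrossTensor β ⊗[𝕜] Y :=
  TensorProduct.map (crossIncl β E) F.1.subtype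

/-- The operator `Q_L T (I_{E₁} × ⋯ × I_{Eₙ}) : E₁ × ⋯ × Eₙ → Y / L`. -/
def localOperator {Y : Type u} [NormedAddCommGroup Y] [NormedSpace 𝕜 Y]
    (T : ContinuousMultilinearMap 𝕜 X Y) (E : ∀ i, FinSub 𝕜 (X i)) (L : CofinSub 𝕜 Y) :
    ContinuousMultilinearMap 𝕜 (fun i => (E i).1) (Y ⧸ L.1) :=
  L.1.mkQL.compContinuousMultilinearMap
    (T.compContinuousLinearMap fun i => (E i).1.subtypeL)

end Local

/-! ### `Σ`-ideals and `Σ`-tensor norms on duals -/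

/-- A `Σ`-ideal of multilinear operators on the class of Banach spaces. -/
structure SigmaIdeal (𝕜 : Type) [RCLike 𝕜] where
  /-- the component `𝒜^β(X₁, …, Xₙ; Y)` -/
  component : ∀ {n : ℕ} [NeZero n] {X : Fin n → Type u} [∀ i, NormedAddCommGroup (X i)]
    [∀ i, NormedSpace 𝕜 (X i)] [∀ i, CompleteSpace (X i)] (_β : ReasonableCrossnorm 𝕜 X)
    (Y : Type u) [NormedAddCommGroup Y] [NormedSpace 𝕜 Y] [CompleteSpace Y],
    Submodule 𝕜 (ContinuousMultilinearMap 𝕜 X Y)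
  /-- the norm `A^β` -/
  idealNorm : ∀ {n : ℕ} [NeZero n] {X : Fin n → Type u} [∀ i, NormedAddCommGroup (X i)]
    [∀ i, NormedSpace 𝕜 (X i)] [∀ i, CompleteSpace (X i)] (β : ReasonableCrossnorm 𝕜 X)
    (Y : Type u) [NormedAddCommGroup Y] [NormedSpace 𝕜 Y] [CompleteSpace Y],
    Seminorm 𝕜 (component β Y)
  eq_zero : ∀ {n : ℕ} [NeZero n] {X : Fin n → Type u} [∀ i, NormedAddCommGroup (X i)]
    [∀ i, NormedSpace 𝕜 (X i)] [∀ i, CompleteSpace (X i)] (β : ReasonableCrossnorm 𝕜 X)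
    (Y : Type u) [NormedAddCommGroup Y] [NormedSpace 𝕜 Y] [CompleteSpace Y]
    (T : component β Y), idealNorm β Y T = 0 → T = 0
  complete : ∀ {n : ℕ} [NeZero n] {X : Fin n → Type u} [∀ i, NormedAddCommGroup (X i)]
    [∀ i, NormedSpace 𝕜 (X i)] [∀ i, CompleteSpace (X i)] (β : ReasonableCrossnorm 𝕜 X)
    (Y : Type u) [NormedAddCommGroup Y] [NormedSpace 𝕜 Y] [CompleteSpace Y]
    (s : ℕ → component β Y),
    (∀ ε > 0, ∃ N, ∀ j ≥ N, ∀ k ≥ N, idealNorm β Y (s j - s k) < ε) →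
    ∃ T : component β Y, ∀ ε > 0, ∃ N, ∀ k ≥ N, idealNorm β Y (s k - T) < ε
  /-- rank-one operators -/
  rankOne_mem : ∀ {n : ℕ} [NeZero n] {X : Fin n → Type u} [∀ i, NormedAddCommGroup (X i)]
    [∀ i, NormedSpace 𝕜 (X i)] [∀ i, CompleteSpace (X i)] (β : ReasonableCrossnorm 𝕜 X)
    (Y : Type u) [NormedAddCommGroup Y] [NormedSpace 𝕜 Y] [CompleteSpace Y]
    (φ : Forms β) (y : Y),
    ∃ h : rankOne β φ y ∈ component β Y, idealNorm β Y ⟨rankOne β φ y, h⟩ ≤ ‖φ‖ * ‖y‖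
  /-- `Lip^β(f_T) ≤ A^β(T)` -/
  lip_le : ∀ {n : ℕ} [NeZero n] {X : Fin n → Type u} [∀ i, NormedAddCommGroup (X i)]
    [∀ i, NormedSpace 𝕜 (X i)] [∀ i, CompleteSpace (X i)] (β : ReasonableCrossnorm 𝕜 X)
    (Y : Type u) [NormedAddCommGroup Y] [NormedSpace 𝕜 Y] [CompleteSpace Y]
    (T : component β Y), ∀ p ∈ segre β, ∀ q ∈ segre β,
    ‖linearization β T.1 p - linearization β T.1 q‖ ≤ idealNorm β Y T * ‖p - q‖
  /-- the ideal property: `S f_T R ∈ 𝒜^θ` with `A^θ(S f_T R) ≤ ‖R‖ A^β(T) ‖S‖` -/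
  comp_mem : ∀ {n : ℕ} [NeZero n] {X : Fin n → Type u} [∀ i, NormedAddCommGroup (X i)]
    [∀ i, NormedSpace 𝕜 (X i)] [∀ i, CompleteSpace (X i)] (β : ReasonableCrossnorm 𝕜 X)
    (Y : Type u) [NormedAddCommGroup Y] [NormedSpace 𝕜 Y] [CompleteSpace Y]
    {m : ℕ} [NeZero m] {Z : Fin m → Type u} [∀ i, NormedAddCommGroup (Z i)]
    [∀ i, NormedSpace 𝕜 (Z i)] [∀ i, CompleteSpace (Z i)] (θ : ReasonableCrossnorm 𝕜 Z)
    (W : Type u) [NormedAddCommGroup W] [NormedSpace 𝕜 W] [CompleteSpace W]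
    (R : CrossTensor θ →L[𝕜] CrossTensor β) (_ : IsSigmaOperator R)
    (T : component β Y) (S : Y →L[𝕜] W),
    ∃ U : component θ W, (∀ z, U.1 z = S (linearization β T.1 (R (tensor θ z)))) ∧
      idealNorm θ W U ≤ ‖R‖ * idealNorm β Y T * ‖S‖

/-- A `Σ`-tensor norm on duals on the class of Banach spaces. -/
structure SigmaTensorNormOnDuals (𝕜 : Type) [RCLike 𝕜] where
  /-- the norm `ν_β` on `ℒ^β(X₁, …, Xₙ) ⊗ Y` -/
  norm : ∀ {n : ℕ} [NeZero n] {X : Fin n → Type u} [∀ i, NormedAddCommGroup (X i)]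
    [∀ i, NormedSpace 𝕜 (X i)] [∀ i, CompleteSpace (X i)] (β : ReasonableCrossnorm 𝕜 X)
    (Y : Type u) [NormedAddCommGroup Y] [NormedSpace 𝕜 Y] [CompleteSpace Y],
    Seminorm 𝕜 (Forms β ⊗[𝕜] Y)
  eq_zero : ∀ {n : ℕ} [NeZero n] {X : Fin n → Type u} [∀ i, NormedAddCommGroup (X i)]
    [∀ i, NormedSpace 𝕜 (X i)] [∀ i, CompleteSpace (X i)] (β : ReasonableCrossnorm 𝕜 X)
    (Y : Type u) [NormedAddCommGroup Y] [NormedSpace 𝕜 Y] [CompleteSpace Y]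
    (v : Forms β ⊗[𝕜] Y), norm β Y v = 0 → v = 0
  /-- `ν_β(φ ⊗ y) ≤ ‖φ‖_β ‖y‖` -/
  tmul_le : ∀ {n : ℕ} [NeZero n] {X : Fin n → Type u} [∀ i, NormedAddCommGroup (X i)]
    [∀ i, NormedSpace 𝕜 (X i)] [∀ i, CompleteSpace (X i)] (β : ReasonableCrossnorm 𝕜 X)
    (Y : Type u) [NormedAddCommGroup Y] [NormedSpace 𝕜 Y] [CompleteSpace Y]
    (φ : Forms β) (y : Y), norm β Y (φ ⊗ₜ[𝕜] y) ≤ ‖φ‖ * ‖y‖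
  /-- the functional `(p - q) ⊗ y*` is bounded with norm at most `β(p - q) ‖y*‖` -/
  evaluation_le : ∀ {n : ℕ} [NeZero n] {X : Fin n → Type u} [∀ i, NormedAddCommGroup (X i)]
    [∀ i, NormedSpace 𝕜 (X i)] [∀ i, CompleteSpace (X i)] (β : ReasonableCrossnorm 𝕜 X)
    (Y : Type u) [NormedAddCommGroup Y] [NormedSpace 𝕜 Y] [CompleteSpace Y],
    ∀ p ∈ segre β, ∀ q ∈ segre β, ∀ (g : StrongDual 𝕜 Y) (v : Forms β ⊗[𝕜] Y),
    ‖evaluationAt (p - q) g v‖ ≤ ‖p - q‖ * ‖g‖ * norm β Y v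
  /-- the uniform property: `‖A ⊗ B‖ ≤ ‖A‖ ‖B‖` whenever `A` preserves `Σ` -/
  map_le : ∀ {n : ℕ} [NeZero n] {X : Fin n → Type u} [∀ i, NormedAddCommGroup (X i)]
    [∀ i, NormedSpace 𝕜 (X i)] [∀ i, CompleteSpace (X i)] (β : ReasonableCrossnorm 𝕜 X)
    (Y : Type u) [NormedAddCommGroup Y] [NormedSpace 𝕜 Y] [CompleteSpace Y]
    {m : ℕ} [NeZero m] {Z : Fin m → Type u} [∀ i, NormedAddCommGroup (Z i)]
    [∀ i, NormedSpace 𝕜 (Z i)] [∀ i, CompleteSpace (Z i)] (θ : ReasonableCrossnorm 𝕜 Z)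
    (W : Type u) [NormedAddCommGroup W] [NormedSpace 𝕜 W] [CompleteSpace W]
    (A : Forms β →L[𝕜] Forms θ) (_ : PreservesSigma A) (B : Y →L[𝕜] W)
    (v : Forms β ⊗[𝕜] Y),
    norm θ W (TensorProduct.map (A : Forms β →ₗ[𝕜] Forms θ) (B : Y →ₗ[𝕜] W) v) ≤
      ‖A‖ * ‖B‖ * norm β Y v

section

variable {𝕜 : Type} [RCLike 𝕜] {n : ℕ} [NeZero n] {X : Fin n → Type u}
  [∀ i, NormedAddCommGroup (X i)] [∀ i, NormedSpace 𝕜 (X i)] [∀ i, CompleteSpace (X i)]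

open Classical in
/-- The ideal norm, extended by `∞` to all bounded multilinear operators outside the component. -/
def SigmaIdeal.extNorm (A : SigmaIdeal.{u} 𝕜) (β : ReasonableCrossnorm 𝕜 X) {Y : Type u}
    [NormedAddCommGroup Y] [NormedSpace 𝕜 Y] [CompleteSpace Y]
    (T : ContinuousMultilinearMap 𝕜 X Y) : ℝ≥0∞ :=
  if h : T ∈ A.component β Y then ENNReal.ofReal (A.idealNorm β Y ⟨T, h⟩) else ∞

end

/-- A `Σ`-ideal is maximal if it coincides with its maximal hull: for every bounded multilinear
operator `T`, `T` is in the component exactly when the supremum of the ideal norms of the operators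
`Q_L T (I_{E₁} × ⋯ × I_{Eₙ})` is finite, and the ideal norm of `T` is then this supremum. -/
def SigmaIdeal.IsMaximal {𝕜 : Type} [RCLike 𝕜] (A : SigmaIdeal.{u} 𝕜) : Prop :=
  ∀ {n : ℕ} [NeZero n] {X : Fin n → Type u} [∀ i, NormedAddCommGroup (X i)]
    [∀ i, NormedSpace 𝕜 (X i)] [∀ i, CompleteSpace (X i)] (β : ReasonableCrossnorm 𝕜 X)
    (Y : Type u) [NormedAddCommGroup Y] [NormedSpace 𝕜 Y] [CompleteSpace Y]
    (T : ContinuousMultilinearMap 𝕜 X Y),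
    A.extNorm β T = ⨆ (E : ∀ i, FinSub 𝕜 (X i)) (L : CofinSub 𝕜 Y),
      A.extNorm (β.restrict E) (localOperator T E L)

/-- `𝒜` and `ν` are associated: for finite dimensional spaces the map `φ ⊗ y ↦ φ · y` is an
isometric isomorphism of `(ℒ^β(E₁, …, Eₙ) ⊗ F, ν_β)` onto `𝒜^β(E₁, …, Eₙ; F)`. -/
def SigmaIdeal.IsAssociated {𝕜 : Type} [RCLike 𝕜] (A : SigmaIdeal.{u} 𝕜)
    (ν : SigmaTensorNormOnDuals.{u} 𝕜) : Prop :=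
  ∀ {n : ℕ} [NeZero n] {E : Fin n → Type u} [∀ i, NormedAddCommGroup (E i)]
    [∀ i, NormedSpace 𝕜 (E i)] [∀ i, CompleteSpace (E i)] [∀ i, FiniteDimensional 𝕜 (E i)]
    (β : ReasonableCrossnorm 𝕜 E)
    (F : Type u) [NormedAddCommGroup F] [NormedSpace 𝕜 F] [CompleteSpace F]
    [FiniteDimensional 𝕜 F],
    ∃ Φ : (Forms β ⊗[𝕜] F) ≃ₗ[𝕜] A.component β F,
      ∀ v, (Φ v : ContinuousMultilinearMap 𝕜 E F) = toOperator β F v ∧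
        A.idealNorm β F (Φ v) = ν.norm β F v

/-! ### Duals -/

section Dual

variable {𝕜 : Type} [RCLike 𝕜] {V : Type u} [AddCommGroup V] [Module 𝕜 V]

/-- The topological dual of `(V, N)`: the linear functionals that are bounded with respect to
`N`. -/
def boundedDual (N : V → ℝ) : Submodule 𝕜 (Module.Dual 𝕜 V) where
  carrier := {φ | ∃ C : ℝ, 0 ≤ C ∧ ∀ u, ‖φ u‖ ≤ C * N u}
  zero_mem' := ⟨0, le_rfl, fun u => by simp⟩
  add_mem' := by
    rintro φ ψ ⟨C, hC, h⟩ ⟨D, hD, k⟩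
    refine ⟨C + D, add_nonneg hC hD, fun u => ?_⟩
    rw [add_mul]
    exact (norm_add_le _ _).trans (add_le_add (h u) (k u))
  smul_mem' := by
    rintro c φ ⟨C, hC, h⟩
    refine ⟨‖c‖ * C, by positivity, fun u => ?_⟩
    rw [LinearMap.smul_apply, norm_smul, mul_assoc]
    exact mul_le_mul_of_nonneg_left (h u) (norm_nonneg c)

/-- The norm of a functional on `(V, N)`. -/
def dualNorm (N : V → ℝ) (φ : Module.Dual 𝕜 V) : ℝ :=
  sInf {C : ℝ | 0 ≤ C ∧ ∀ u, ‖φ u‖ ≤ C * N u}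

end Dual

section

variable {𝕜 : Type} [RCLike 𝕜] {n : ℕ} [NeZero n] {X : Fin n → Type u}
  [∀ i, NormedAddCommGroup (X i)] [∀ i, NormedSpace 𝕜 (X i)] [∀ i, CompleteSpace (X i)]

/-- The norm on `E₁ ⊗ ⋯ ⊗ Eₙ ⊗ F` (for finite dimensional spaces) for which it is the dual
`(ℒ^β(E₁, …, Eₙ) ⊗ F*, ν_β)*`, tensors acting by evaluation. -/
def SigmaTensorNormOnDuals.finDual (ν : SigmaTensorNormOnDuals.{u} 𝕜)
    (β : ReasonableCrossnorm 𝕜 X) (F : Type u) [NormedAddCommGroup F] [NormedSpace 𝕜 F]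
    [CompleteSpace F] (u : CrossTensor β ⊗[𝕜] F) : ℝ :=
  dualNorm (ν.norm β (StrongDual 𝕜 F)) ((evaluation β F).flip u)

/-- The finitely generated `Σ`-tensor norm on spaces `α` defined by `ν`: `α^β(u)` is the infimum
of the norms of `u` in `E₁ ⊗ ⋯ ⊗ Eₙ ⊗ F = (ℒ^{β|}(E₁, …, Eₙ) ⊗ F*, ν_{β|})*` over all finite
dimensional subspaces with `u ∈ E₁ ⊗ ⋯ ⊗ Eₙ ⊗ F`. -/
def SigmaTensorNormOnDuals.onSpaces (ν : SigmaTensorNormOnDuals.{u} 𝕜)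
    (β : ReasonableCrossnorm 𝕜 X) (Y : Type u) [NormedAddCommGroup Y] [NormedSpace 𝕜 Y]
    [CompleteSpace Y] (u : CrossTensor β ⊗[𝕜] Y) : ℝ :=
  sInf {r : ℝ | ∃ (E : ∀ i, FinSub 𝕜 (X i)) (F : FinSub 𝕜 Y)
    (w : CrossTensor (β.restrict E) ⊗[𝕜] F.1),
    incl β E F w = u ∧ r = ν.finDual (β.restrict E) F.1 w}

/-- `(X₁ ⊗ ⋯ ⊗ Xₙ ⊗ Y*, N)* ∩ ℒ(X₁, …, Xₙ; Y)`: the bounded functionals `φ` of the form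
`φ(x₁ ⊗ ⋯ ⊗ xₙ ⊗ y*) = y*(T(x₁, …, xₙ))` with a bounded multilinear operator
`T : X₁ × ⋯ × Xₙ → Y`. -/
def dualInterOperators (β : ReasonableCrossnorm 𝕜 X) (Y : Type u) [NormedAddCommGroup Y]
    [NormedSpace 𝕜 Y] (N : CrossTensor β ⊗[𝕜] StrongDual 𝕜 Y → ℝ) :
    Submodule 𝕜 (Module.Dual 𝕜 (CrossTensor β ⊗[𝕜] StrongDual 𝕜 Y)) where
  carrier := {φ | φ ∈ boundedDual (𝕜 := 𝕜) N ∧ ∃ T : ContinuousMultilinearMap 𝕜 X Y,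
    ∀ x g, φ (tensor β x ⊗ₜ[𝕜] g) = g (T x)}
  zero_mem' := ⟨Submodule.zero_mem _, 0, fun x g => by simp⟩
  add_mem' := by
    rintro φ ψ ⟨h, T, hT⟩ ⟨k, S, hS⟩
    exact ⟨Submodule.add_mem _ h k, T + S, fun x g => by simp [hT, hS]⟩
  smul_mem' := by
    rintro c φ ⟨h, T, hT⟩
    exact ⟨Submodule.smul_mem _ c h, c • T, fun x g => by simp [hT]⟩

end

end SigmaIdeals

end

open SigmaIdeals

/-! Both identifications rest on one comparison. An operator `T` into `Y` defines a functional
`operatorForm β T` on `X₁ ⊗ ⋯ ⊗ Xₙ ⊗ Y*`, and `A^β(T) ≤ C` holds exactly when this functional is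
bounded by `C · α^β` (`idealNorm_le_iff_operatorForm`). Maximality reduces the left side to the
operators `Q_L T|_E`. Since `α` is finitely generated, the right side reduces to the restrictions to
`E₁ ⊗ ⋯ ⊗ Eₙ ⊗ F` with `F ⊂ Y*` finite dimensional. Annihilators match the two families: `Y/L` maps
contractively into `F*` when `F` vanishes on `L`, and `Y/L = F*` isometrically when `F` is the
annihilator of `L`. On each finite dimensional piece association turns `A` into `ν`, and `ν` is
recovered from its dual norm `finDual` by reflexivity.

This already gives the statement about operators into `Y`. For operators into `Y*` it gives
functionals on `X₁ ⊗ ⋯ ⊗ Xₙ ⊗ Y**`, and it remains to replace `Y**` by `Y`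
(`norm_operatorForm_le_iff`). Passing from `Y**` to `Y` uses the canonical embedding. The converse
needs local reflexivity in a weak form (`norm_sum_bidual_le`): a tensor in `F ⊗ Y*` has the same
bound on operators `F → Y**` as on operators `F → Y`. Finally, every bounded functional on `X₁ ⊗ ⋯ ⊗
Xₙ ⊗ Y` comes from an operator into `Y*`, because `α^β` is at most the product of the norms on
elementary tensors. -/

namespace SigmaIdeals

/-! ### Local reflexivity -/

section LocalReflexivity

variable {𝕜 : Type*} [RCLike 𝕜]

/-- A finite subset of the unit ball of a finite dimensional space which almost determines the
norm of every operator on that space. -/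
theorem exists_finite_almost_norming (F : Type*) [NormedAddCommGroup F] [NormedSpace 𝕜 F]
    [FiniteDimensional 𝕜 F] {ε : ℝ} (hε : 0 < ε) :
    ∃ s : Finset F, (∀ f ∈ s, ‖f‖ ≤ 1) ∧
      ∀ {Y : Type*} [NormedAddCommGroup Y] [NormedSpace 𝕜 Y] (R : F →L[𝕜] Y) (c : ℝ), 0 ≤ c →
        (∀ f ∈ s, ‖R f‖ ≤ c) → (1 - ε) * ‖R‖ ≤ c := by
  have := FiniteDimensional.proper 𝕜 F
  -- The set is an `ε`-net of the compact unit ball; replacing a unit vector by a net point costs `ε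
  -- * ‖R‖`, which is absorbed on the left.
  obtain ⟨t, hts, htf, hcov⟩ := (isCompact_closedBall (0 : F) 1).finite_cover_balls hε
  refine ⟨htf.toFinset, fun f hf => ?_, fun {Y} _ _ R c hc hR => ?_⟩
  · simpa using hts (htf.mem_toFinset.1 hf)
  · let : NormedSpace ℝ F := NormedSpace.restrictScalars ℝ 𝕜 F
    have key : ‖R‖ ≤ c + ε * ‖R‖ := by
      refine R.opNorm_le_of_unit_norm (by positivity) fun x hx => ?_
      obtain ⟨f, hf, hxf⟩ := Set.mem_iUnion₂.1 (hcov (show x ∈ Metric.closedBall 0 1 by simp [hx]))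
      have h1 : ‖R f‖ ≤ c := hR f (htf.mem_toFinset.2 hf)
      have h2 : ‖R (x - f)‖ ≤ ‖R‖ * ε :=
        (R.le_opNorm _).trans (by
          gcongr
          exact (mem_ball_iff_norm.1 hxf).le)
      calc ‖R x‖ = ‖R f + R (x - f)‖ := by rw [← map_add, add_sub_cancel]
        _ ≤ ‖R f‖ + ‖R (x - f)‖ := norm_add_le _ _
        _ ≤ c + ε * ‖R‖ := by linarith
    linarith

/-- The norm of a functional on a finite product bounds the sum of the norms of its parts. -/
theorem sum_norm_comp_single_le {ι : Type*} [Fintype ι] [DecidableEq ι] {Y : Type*}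
    [NormedAddCommGroup Y] [NormedSpace 𝕜 Y] (h : StrongDual 𝕜 (ι → Y)) :
    ∑ j, ‖h.comp (ContinuousLinearMap.single 𝕜 (fun _ : ι => Y) j)‖ ≤ ‖h‖ := by
  set g := fun j => h.comp (ContinuousLinearMap.single 𝕜 (fun _ : ι => Y) j) with hg
  refine le_of_forall_pos_le_add fun ε hε => ?_
  -- Each coordinate may lose `δ`, and the total loss stays below `ε`; the `+ 1` covers an empty
  -- index set.
  set δ := ε / (Fintype.card ι + 1) with hδ
  have hδ0 : 0 < δ := by positivity
  have h1 : ∀ j, ∃ y : Y, ‖y‖ ≤ 1 ∧ ∃ r : ℝ, g j y = (r : 𝕜) ∧ ‖g j‖ - δ ≤ r := by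
    intro j
    obtain ⟨x, hx, hr⟩ := (g j).exists_lt_apply_of_lt_opNorm (sub_lt_self ‖g j‖ hδ0)
    -- A unimodular rotation makes each value real and nonnegative, so that the values on the single
    -- coordinates add up without cancellation.
    obtain ⟨c, hc, hcx⟩ := RCLike.exists_norm_eq_mul_self (g j x)
    refine ⟨c • x, by rw [norm_smul, hc, one_mul]; exact hx.le, ‖g j x‖, ?_, hr.le⟩
    rw [map_smul, smul_eq_mul, hcx]
  choose y hy r hr hgr using h1
  have h2 : h y = ((∑ j, r j : ℝ) : 𝕜) := by
    conv_lhs => rw [← Finset.univ_sum_single y]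
    rw [map_sum, RCLike.ofReal_sum]
    exact Finset.sum_congr rfl fun j _ => hr j
  have h3 : ∑ j, r j ≤ ‖h‖ := by
    calc ∑ j, r j ≤ ‖h y‖ := by rw [h2, RCLike.norm_ofReal]; exact le_abs_self _
      _ ≤ ‖h‖ * ‖y‖ := h.le_opNorm y
      _ ≤ ‖h‖ := mul_le_of_le_one_right (norm_nonneg _)
        ((pi_norm_le_iff_of_nonneg zero_le_one).2 hy)
  have h4 : ∑ j, (‖g j‖ - δ) ≤ ∑ j, r j := Finset.sum_le_sum fun j _ => hgr j
  rw [Finset.sum_sub_distrib, Finset.sum_const, Finset.card_univ, nsmul_eq_mul] at h4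
  have h5 : Fintype.card ι * δ ≤ ε := by
    rw [hδ, mul_div_assoc', div_le_iff₀ (by positivity)]
    nlinarith
  linarith

/-- An operator into the bidual pairs with a finite sum of elementary tensors through the
coordinates of that sum. -/
theorem sum_apply_eq_sum_basis {F Y : Type*} [NormedAddCommGroup F] [NormedSpace 𝕜 F]
    [NormedAddCommGroup Y] [NormedSpace 𝕜 Y] {κ ι : Type*} [Fintype κ] (b : Module.Basis κ 𝕜 F)
    (s : Finset ι) (e : ι → F) (l : ι → StrongDual 𝕜 Y)
    (S : F →ₗ[𝕜] StrongDual 𝕜 (StrongDual 𝕜 Y)) :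
    ∑ i ∈ s, S (e i) (l i) = ∑ k, S (b k) (∑ i ∈ s, b.repr (e i) k • l i) := by
  simp only [map_sum, map_smul]
  rw [Finset.sum_comm]
  refine Finset.sum_congr rfl fun i _ => ?_
  conv_lhs => rw [← b.sum_repr (e i), map_sum, sum_apply]
  simp

/-- A form of local reflexivity: a functional on the space of operators from a finite dimensional
space `F` into `Y`, given by a tensor in `F ⊗ Y*`, has the same bound on the operators from `F`
into the bidual of `Y` as well; it is stated for contractions `S` of the latter kind. -/
theorem norm_sum_bidual_le {F Y : Type*} [NormedAddCommGroup F] [NormedSpace 𝕜 F]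
    [FiniteDimensional 𝕜 F] [NormedAddCommGroup Y] [NormedSpace 𝕜 Y] {ι : Type*}
    (t : Finset ι) (e : ι → F) (l : ι → StrongDual 𝕜 Y) {C : ℝ} (hC : 0 ≤ C)
    (hl : ∀ R : F →L[𝕜] Y, ‖∑ i ∈ t, l i (R (e i))‖ ≤ C * ‖R‖)
    (S : F →ₗ[𝕜] StrongDual 𝕜 (StrongDual 𝕜 Y)) (hS : ∀ f, ‖S f‖ ≤ ‖f‖) :
    ‖∑ i ∈ t, S (e i) (l i)‖ ≤ C := by
  classical
  have main : ∀ ε : ℝ, 0 < ε → ε < 1 → (1 - ε) * ‖∑ i ∈ t, S (e i) (l i)‖ ≤ C := by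
    intro ε hε hε1
    have hε' : 0 < 1 - ε := by linarith
    obtain ⟨s, hs1, hs⟩ := exists_finite_almost_norming (𝕜 := 𝕜) F hε
    -- Evaluation on the net embeds the operators almost isometrically into a finite sup-normed
    -- power of `Y`, whose functionals are tuples with summable norms.
    let Θ : (F →L[𝕜] Y) →ₗ[𝕜] (s → Y) := LinearMap.pi fun f =>
      (ContinuousLinearMap.apply 𝕜 Y (f : F) : (F →L[𝕜] Y) →L[𝕜] Y)
    have hΘ : ∀ R, (1 - ε) * ‖R‖ ≤ ‖Θ R‖ := fun R =>
      hs R _ (norm_nonneg _) fun f hf => norm_le_pi_norm (Θ R) ⟨f, hf⟩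
    have hinj : Function.Injective Θ := by
      rw [injective_iff_map_eq_zero]
      intro R hR
      have := hΘ R
      rw [hR, norm_zero] at this
      exact norm_le_zero_iff.1 (nonpos_of_mul_nonpos_right this hε')
    let Λ : (F →L[𝕜] Y) →ₗ[𝕜] 𝕜 := ∑ i ∈ t, (l i : Y →ₗ[𝕜] 𝕜) ∘ₗ
      (ContinuousLinearMap.apply 𝕜 Y (e i) : (F →L[𝕜] Y) →L[𝕜] Y)
    have hΛ : ∀ R, Λ R = ∑ i ∈ t, l i (R (e i)) := fun R => by simp [Λ]
    let ΘE := LinearEquiv.ofInjective Θ hinj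
    -- Transport to the range of `Θ` costs the factor `1 / (1 - ε)`; the Hahn–Banach extension costs
    -- nothing more.
    let p : StrongDual 𝕜 (LinearMap.range Θ) :=
      (Λ ∘ₗ (ΘE.symm : LinearMap.range Θ →ₗ[𝕜] (F →L[𝕜] Y))).mkContinuous (C / (1 - ε)) <| by
        intro z
        obtain ⟨R, rfl⟩ := ΘE.surjective z
        have h1 : ‖ΘE R‖ = ‖Θ R‖ := rfl
        rw [LinearMap.comp_apply, LinearEquiv.coe_coe, ΘE.symm_apply_apply, hΛ, h1,
          div_mul_eq_mul_div, le_div_iff₀ hε']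
        calc _ ≤ C * ‖R‖ * (1 - ε) := by gcongr; exact hl R
          _ = C * ((1 - ε) * ‖R‖) := by ring
          _ ≤ C * ‖Θ R‖ := by gcongr; exact hΘ R
    have hp : ‖p‖ ≤ C / (1 - ε) := LinearMap.mkContinuous_norm_le _ (by positivity) _
    obtain ⟨h, hhp, hn⟩ := exists_extension_norm_eq _ p
    let g := fun j : s => h.comp (ContinuousLinearMap.single 𝕜 (fun _ : s => Y) j)
    have hg : ∀ R : F →L[𝕜] Y, ∑ j, g j (R j) = ∑ i ∈ t, l i (R (e i)) := by
      intro R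
      rw [← hΛ]
      have h1 : h (Θ R) = Λ R := by
        have := hhp (ΘE R)
        have h2 : p (ΘE R) = Λ (ΘE.symm (ΘE R)) := rfl
        rw [h2, ΘE.symm_apply_apply] at this
        exact this
      rw [← h1]
      conv_rhs => rw [← Finset.univ_sum_single (Θ R)]
      rw [map_sum]
      rfl
    let b := Module.finBasis 𝕜 F
    -- The tensors `∑ eᵢ ⊗ lᵢ` and `∑ j ⊗ gⱼ` agree on all operators `F → Y`. Testing on the
    -- rank-one operators `b.coord k ⊗ y` shows that their coordinates in `Y*` coincide, so they
    -- also agree on operators into the bidual.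
    have htr : ∑ i ∈ t, S (e i) (l i) = ∑ j : s, S (j : F) (g j) := by
      rw [sum_apply_eq_sum_basis b, sum_apply_eq_sum_basis b Finset.univ (fun j : s => (j : F)) g]
      refine Finset.sum_congr rfl fun k _ => ?_
      congr 1
      ext y
      have := hg ((LinearMap.toContinuousLinearMap (b.coord k)).smulRight y)
      simpa using this.symm
    have hsum : ‖∑ i ∈ t, S (e i) (l i)‖ ≤ C / (1 - ε) := by
      rw [htr]
      calc _ ≤ ∑ j : s, ‖S (j : F) (g j)‖ := norm_sum_le _ _
        _ ≤ ∑ j : s, ‖g j‖ := by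
          refine Finset.sum_le_sum fun j _ => ?_
          refine ((S (j : F)).le_opNorm _).trans ?_
          exact mul_le_of_le_one_left (norm_nonneg _) ((hS _).trans (hs1 j j.2))
        _ ≤ C / (1 - ε) := (sum_norm_comp_single_le h).trans (hn.le.trans hp)
    rwa [le_div_iff₀ hε', mul_comm] at hsum
  have hlim : Filter.Tendsto (fun ε : ℝ => (1 - ε) * ‖∑ i ∈ t, S (e i) (l i)‖)
      (nhdsWithin 0 (Set.Ioi 0)) (nhds ((1 - 0) * ‖∑ i ∈ t, S (e i) (l i)‖)) :=
    ((continuous_const.sub continuous_id).mul continuous_const).continuousAt.mono_left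
      nhdsWithin_le_nhds
  rw [sub_zero, one_mul] at hlim
  refine le_of_tendsto hlim ?_
  filter_upwards [Ioo_mem_nhdsGT (zero_lt_one' ℝ)] with ε hε
  exact main ε hε.1 hε.2

end LocalReflexivity

/-! ### Functionals bounded with respect to a seminorm -/

section Dual

variable {𝕜 : Type} [RCLike 𝕜] {V : Type u} [AddCommGroup V] [Module 𝕜 V]

theorem dualNorm_nonneg (N : V → ℝ) (φ : Module.Dual 𝕜 V) : 0 ≤ dualNorm N φ :=
  Real.sInf_nonneg fun _ h => h.1

theorem dualNorm_le {N : V → ℝ} {φ : Module.Dual 𝕜 V} {C : ℝ} (hC : 0 ≤ C)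
    (h : ∀ u, ‖φ u‖ ≤ C * N u) : dualNorm N φ ≤ C :=
  csInf_le ⟨0, fun _ h => h.1⟩ ⟨hC, h⟩

/-- Boundedness is needed because `dualNorm` is a real infimum, which would be `0` over an empty set
of constants. -/
theorem norm_le_dualNorm_mul {N : V → ℝ} (hN : ∀ u, 0 ≤ N u) {φ : Module.Dual 𝕜 V}
    (hφ : φ ∈ boundedDual (𝕜 := 𝕜) N) (u : V) : ‖φ u‖ ≤ dualNorm N φ * N u := by
  rcases (hN u).eq_or_lt with h0 | h0
  · obtain ⟨C, _, h⟩ := hφ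
    simpa [← h0] using h u
  · rw [← div_le_iff₀ h0]
    obtain ⟨C, hC⟩ := hφ
    refine le_csInf ⟨C, hC⟩ fun D hD => ?_
    rw [div_le_iff₀ h0]
    exact hD.2 u

/-- Every functional on a finite dimensional space is bounded with respect to any norm. -/
theorem mem_boundedDual_of_finiteDimensional [FiniteDimensional 𝕜 V] (N : Seminorm 𝕜 V)
    (hN : ∀ u, N u = 0 → u = 0) (φ : Module.Dual 𝕜 V) : φ ∈ boundedDual (𝕜 := 𝕜) (N : V → ℝ) := by
  let : Norm V := ⟨N⟩
  have core : NormedSpace.Core 𝕜 V :=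
    ⟨⟨fun u => apply_nonneg N u, fun c u => map_smul_eq_mul N c u,
      fun u v => map_add_le_add N u v⟩, fun u => ⟨hN u, fun h => by rw [h]; exact map_zero N⟩⟩
  let : NormedAddCommGroup V := NormedAddCommGroup.ofCore core
  let : NormedSpace 𝕜 V := NormedSpace.ofCore core
  exact ⟨‖LinearMap.toContinuousLinearMap φ‖, norm_nonneg _, fun u =>
    (LinearMap.toContinuousLinearMap φ).le_opNorm u⟩

/-- Norming functionals with respect to a given norm. -/
theorem exists_norming_functional (N : Seminorm 𝕜 V) (hN : ∀ u, N u = 0 → u = 0) (v : V) :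
    ∃ φ : Module.Dual 𝕜 V, (∀ u, ‖φ u‖ ≤ N u) ∧ φ v = (N v : 𝕜) := by
  let : Norm V := ⟨N⟩
  have core : NormedSpace.Core 𝕜 V :=
    ⟨⟨fun u => apply_nonneg N u, fun c u => map_smul_eq_mul N c u,
      fun u v => map_add_le_add N u v⟩, fun u => ⟨hN u, fun h => by rw [h]; exact map_zero N⟩⟩
  let : NormedAddCommGroup V := NormedAddCommGroup.ofCore core
  let : NormedSpace 𝕜 V := NormedSpace.ofCore core
  obtain ⟨g, hg, hv⟩ := exists_dual_vector'' 𝕜 v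
  exact ⟨g, fun u => (g.le_opNorm u).trans (mul_le_of_le_one_left (norm_nonneg _) hg), hv⟩

end Dual

/-! ### The tensor product `(X₁ ⊗ ⋯ ⊗ Xₙ, β)` -/

section CrossTensor

variable {𝕜 : Type} [RCLike 𝕜] {n : ℕ} {X : Fin n → Type u}
  [∀ i, NormedAddCommGroup (X i)] [∀ i, NormedSpace 𝕜 (X i)]

theorem span_segre (β : ReasonableCrossnorm 𝕜 X) : Submodule.span 𝕜 (segre β) = ⊤ :=
  PiTensorProduct.span_tprod_eq_top (R := 𝕜) (s := X)

theorem crossTensor_ext {β : ReasonableCrossnorm 𝕜 X} {M : Type*} [AddCommGroup M] [Module 𝕜 M]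
    {f g : CrossTensor β →ₗ[𝕜] M} (h : ∀ x, f (tensor β x) = g (tensor β x)) : f = g :=
  LinearMap.ext_on (span_segre β) (by rintro _ ⟨x, rfl⟩; exact h x)

theorem crossTensor_tmul_ext {β : ReasonableCrossnorm 𝕜 X} {Y M : Type*} [AddCommGroup Y]
    [Module 𝕜 Y] [AddCommGroup M] [Module 𝕜 M] {f g : CrossTensor β ⊗[𝕜] Y →ₗ[𝕜] M}
    (h : ∀ x y, f (tensor β x ⊗ₜ[𝕜] y) = g (tensor β x ⊗ₜ[𝕜] y)) : f = g := by
  apply TensorProduct.ext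
  apply crossTensor_ext
  intro x
  ext y
  exact h x y

@[simp]
theorem linearization_tensor (β : ReasonableCrossnorm 𝕜 X) {Y : Type u} [NormedAddCommGroup Y]
    [NormedSpace 𝕜 Y] (T : ContinuousMultilinearMap 𝕜 X Y) (x : ∀ i, X i) :
    linearization β T (tensor β x) = T x :=
  PiTensorProduct.lift.tprod (φ := T.toMultilinearMap) x

theorem norm_tensor_le (β : ReasonableCrossnorm 𝕜 X) (x : ∀ i, X i) :
    ‖tensor β x‖ ≤ ∏ i, ‖x i‖ :=
  (β.le_projective _).trans (PiTensorProduct.projectiveSeminorm_tprod_le x)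

@[simp]
theorem crossIncl_tensor (β : ReasonableCrossnorm 𝕜 X) (E : ∀ i, FinSub 𝕜 (X i))
    (x : ∀ i, (E i).1) :
    crossIncl β E (tensor (β.restrict E) x) = tensor β fun i => (x i : X i) :=
  PiTensorProduct.map_tprod _ x

instance finiteDimensional_crossTensor [∀ i, FiniteDimensional 𝕜 (X i)]
    (β : ReasonableCrossnorm 𝕜 X) : FiniteDimensional 𝕜 (CrossTensor β) :=
  Module.Basis.finiteDimensional_of_finite
    (Basis.piTensorProduct fun i => Module.finBasis 𝕜 (X i))

instance finiteDimensional_strongDual {V : Type*} [NormedAddCommGroup V] [NormedSpace 𝕜 V]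
    [FiniteDimensional 𝕜 V] : FiniteDimensional 𝕜 (StrongDual 𝕜 V) :=
  LinearEquiv.finiteDimensional
    (LinearMap.toContinuousLinearMap : (V →ₗ[𝕜] 𝕜) ≃ₗ[𝕜] (V →L[𝕜] 𝕜))

@[simp]
theorem toOperator_tmul_apply (β : ReasonableCrossnorm 𝕜 X) {Y : Type u} [NormedAddCommGroup Y]
    [NormedSpace 𝕜 Y] (φ : Forms β) (y : Y) (x : ∀ i, X i) :
    toOperator β Y (φ ⊗ₜ[𝕜] y) x = φ (tensor β x) • y := rfl

@[simp]
theorem evaluation_tmul_tmul (β : ReasonableCrossnorm 𝕜 X) {Y : Type u} [NormedAddCommGroup Y]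
    [NormedSpace 𝕜 Y] (φ : Forms β) (g : StrongDual 𝕜 Y) (w : CrossTensor β) (y : Y) :
    evaluation β Y (φ ⊗ₜ[𝕜] g) (w ⊗ₜ[𝕜] y) = φ w * g y := rfl

/-- For finite dimensional spaces every multilinear operator has finite rank. -/
theorem toOperator_surjective [∀ i, FiniteDimensional 𝕜 (X i)] (β : ReasonableCrossnorm 𝕜 X)
    (Y : Type u) [NormedAddCommGroup Y] [NormedSpace 𝕜 Y] [FiniteDimensional 𝕜 Y] :
    Function.Surjective (toOperator β Y) := by
  intro T
  let b := Module.finBasis 𝕜 Y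
  -- The coordinates of `T` in a basis of `Y`, which are continuous since the tensor product is
  -- finite dimensional.
  refine ⟨∑ k, LinearMap.toContinuousLinearMap (b.coord k ∘ₗ linearization β T) ⊗ₜ[𝕜] b k, ?_⟩
  ext x
  simp [map_sum, b.sum_repr]

theorem strongDual_eq_sum_basis {V κ : Type*} [NormedAddCommGroup V] [NormedSpace 𝕜 V]
    [FiniteDimensional 𝕜 V] [Fintype κ] (b : Module.Basis κ 𝕜 V) (φ : StrongDual 𝕜 V) :
    φ = ∑ i, φ (b i) • LinearMap.toContinuousLinearMap (b.coord i) := by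
  ext w
  conv_lhs => rw [← b.sum_repr w, map_sum]
  simp [mul_comm]

/-- For finite dimensional spaces `X₁ ⊗ ⋯ ⊗ Xₙ ⊗ Y` is the dual of `ℒ^β(X₁, …, Xₙ) ⊗ Y*`. -/
theorem evaluation_flip_surjective [∀ i, FiniteDimensional 𝕜 (X i)]
    (β : ReasonableCrossnorm 𝕜 X) (Y : Type u) [NormedAddCommGroup Y] [NormedSpace 𝕜 Y]
    [FiniteDimensional 𝕜 Y] : Function.Surjective (evaluation β Y).flip := by
  intro ψ
  let b := Module.finBasis 𝕜 (CrossTensor β)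
  let c := Module.finBasis 𝕜 Y
  -- The coefficients are the values of `ψ` on the tensors of the two dual bases.
  refine ⟨∑ i, ∑ j, ψ (LinearMap.toContinuousLinearMap (b.coord i) ⊗ₜ[𝕜]
    LinearMap.toContinuousLinearMap (c.coord j)) • (b i ⊗ₜ[𝕜] c j), ?_⟩
  apply TensorProduct.ext'
  intro φ g
  conv_rhs => rw [strongDual_eq_sum_basis b φ, strongDual_eq_sum_basis c g]
  simp only [map_sum, map_smul, LinearMap.sum_apply, LinearMap.smul_apply, LinearMap.flip_apply,
    evaluation_tmul_tmul, TensorProduct.sum_tmul, TensorProduct.tmul_sum,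
    ← TensorProduct.smul_tmul', TensorProduct.tmul_smul, smul_eq_mul]
  simp only [Finset.mul_sum]
  rw [Finset.sum_comm]
  refine Finset.sum_congr rfl fun i _ => Finset.sum_congr rfl fun j _ => ?_
  ring

end CrossTensor

/-! ### Duality between `ν` and `finDual` on finite dimensional spaces. -/

section FinDual

variable {𝕜 : Type} [RCLike 𝕜] (ν : SigmaTensorNormOnDuals.{u} 𝕜) {n : ℕ} [NeZero n]
  {X : Fin n → Type u} [∀ i, NormedAddCommGroup (X i)] [∀ i, NormedSpace 𝕜 (X i)]
  [∀ i, CompleteSpace (X i)]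

/-- The uniform property with `A` the identity, which trivially preserves `Σ`. -/
theorem norm_map_id_le (β : ReasonableCrossnorm 𝕜 X) {Y W : Type u} [NormedAddCommGroup Y]
    [NormedSpace 𝕜 Y] [CompleteSpace Y] [NormedAddCommGroup W] [NormedSpace 𝕜 W]
    [CompleteSpace W] (B : Y →L[𝕜] W) (v : Forms β ⊗[𝕜] Y) :
    ν.norm β W (TensorProduct.map LinearMap.id (B : Y →ₗ[𝕜] W) v) ≤ ‖B‖ * ν.norm β Y v := by
  have h := ν.map_le β Y β W (ContinuousLinearMap.id 𝕜 _) (fun q hq => ⟨q, hq, rfl⟩) B v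
  refine h.trans ?_
  gcongr
  exact mul_le_of_le_one_left (norm_nonneg _) ContinuousLinearMap.norm_id_le

theorem norm_map_id_le_of_contraction (β : ReasonableCrossnorm 𝕜 X) {Y W : Type u}
    [NormedAddCommGroup Y] [NormedSpace 𝕜 Y] [CompleteSpace Y] [NormedAddCommGroup W]
    [NormedSpace 𝕜 W] [CompleteSpace W] (B : Y →ₗ[𝕜] W) (hB : ∀ y, ‖B y‖ ≤ ‖y‖)
    (v : Forms β ⊗[𝕜] Y) :
    ν.norm β W (TensorProduct.map LinearMap.id B v) ≤ ν.norm β Y v := by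
  have hB' : ∀ y, ‖B y‖ ≤ 1 * ‖y‖ := fun y => by rw [one_mul]; exact hB y
  exact (norm_map_id_le ν β (B.mkContinuous 1 hB') v).trans
    (mul_le_of_le_one_left (apply_nonneg _ _) (LinearMap.mkContinuous_norm_le _ zero_le_one _))

theorem finDual_nonneg (β : ReasonableCrossnorm 𝕜 X) (F : Type u) [NormedAddCommGroup F]
    [NormedSpace 𝕜 F] [CompleteSpace F] (w : CrossTensor β ⊗[𝕜] F) : 0 ≤ ν.finDual β F w :=
  dualNorm_nonneg _ _

variable [∀ i, FiniteDimensional 𝕜 (X i)] (β : ReasonableCrossnorm 𝕜 X) {F : Type u}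
  [NormedAddCommGroup F] [NormedSpace 𝕜 F] [CompleteSpace F] [FiniteDimensional 𝕜 F]

theorem norm_evaluation_le (v : Forms β ⊗[𝕜] StrongDual 𝕜 F) (w : CrossTensor β ⊗[𝕜] F) :
    ‖evaluation β F v w‖ ≤ ν.finDual β F w * ν.norm β (StrongDual 𝕜 F) v :=
  norm_le_dualNorm_mul (fun _ => apply_nonneg _ _)
    (mem_boundedDual_of_finiteDimensional _ (ν.eq_zero β _) ((evaluation β F).flip w)) v

/-- Reflexivity in finite dimensions: a norming functional for `v` is evaluation at some `w`, and
its being norming means `finDual w ≤ 1`. -/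
theorem norm_le_of_evaluation_le (v : Forms β ⊗[𝕜] StrongDual 𝕜 F) {C : ℝ}
    (hC : 0 ≤ C) (h : ∀ w, ‖evaluation β F v w‖ ≤ C * ν.finDual β F w) :
    ν.norm β (StrongDual 𝕜 F) v ≤ C := by
  obtain ⟨ψ, hψ, hv⟩ := exists_norming_functional _ (ν.eq_zero β (StrongDual 𝕜 F)) v
  obtain ⟨w, rfl⟩ := evaluation_flip_surjective β F ψ
  have h1 : ν.finDual β F w ≤ 1 := dualNorm_le zero_le_one fun u => by
    rw [one_mul]; exact hψ u
  have h2 := h w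
  rw [LinearMap.flip_apply] at hv
  rw [hv, RCLike.norm_ofReal, abs_of_nonneg (apply_nonneg _ _)] at h2
  exact h2.trans (mul_le_of_le_one_right hC h1)

/-- The metric mapping property of the norm on `X₁ ⊗ ⋯ ⊗ Xₙ ⊗ F` in the last variable. -/
theorem finDual_map_le {G : Type u} [NormedAddCommGroup G] [NormedSpace 𝕜 G] [CompleteSpace G]
    (B : F →ₗ[𝕜] G) {c : ℝ} (hc : 0 ≤ c) (hB : ∀ f, ‖B f‖ ≤ c * ‖f‖) (w : CrossTensor β ⊗[𝕜] F) :
    ν.finDual β G (TensorProduct.map LinearMap.id B w) ≤ c * ν.finDual β F w := by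
  refine dualNorm_le (mul_nonneg hc (finDual_nonneg ν β F w)) fun v => ?_
  -- The dual norm is handled by moving `B` to the other side as its transpose, to which the uniform
  -- property of `ν` applies.
  let Bt : StrongDual 𝕜 G →L[𝕜] StrongDual 𝕜 F :=
    (ContinuousLinearMap.compL 𝕜 F G 𝕜).flip (B.mkContinuous c hB)
  have hBt : ‖Bt‖ ≤ c := by
    refine Bt.opNorm_le_bound hc fun g => ?_
    rw [mul_comm]
    exact (g.opNorm_comp_le _).trans (by gcongr; exact LinearMap.mkContinuous_norm_le _ hc _)
  have key : evaluation β G v (TensorProduct.map LinearMap.id B w) =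
      evaluation β F (TensorProduct.map LinearMap.id (Bt : StrongDual 𝕜 G →ₗ[𝕜] _) v) w := by
    induction v with
    | zero => simp
    | add v v' h h' => simp only [map_add, LinearMap.add_apply, h, h']
    | tmul φ g =>
      induction w with
      | zero => simp
      | add w w' h h' => simp only [map_add, h, h']
      | tmul x f => rfl
  rw [LinearMap.flip_apply, key]
  calc _ ≤ ν.finDual β F w * _ := norm_evaluation_le ν β _ w
    _ ≤ ν.finDual β F w * (c * ν.norm β (StrongDual 𝕜 G) v) := by
      gcongr
      · exact finDual_nonneg ν β F w
      · exact (norm_map_id_le ν β Bt v).trans (by gcongr)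
    _ = _ := by ring

variable {Q : Type u} [NormedAddCommGroup Q] [NormedSpace 𝕜 Q] [CompleteSpace Q]
  (J : Q →ₗ[𝕜] StrongDual 𝕜 F) (v : Forms β ⊗[𝕜] Q)

theorem norm_evaluation_map_le (hJ : ∀ q, ‖J q‖ ≤ ‖q‖) {C : ℝ} (hv : ν.norm β Q v ≤ C)
    (w : CrossTensor β ⊗[𝕜] F) :
    ‖evaluation β F (TensorProduct.map LinearMap.id J v) w‖ ≤ C * ν.finDual β F w := by
  refine (norm_evaluation_le ν β _ w).trans ?_
  rw [mul_comm]
  exact mul_le_mul_of_nonneg_right ((norm_map_id_le_of_contraction ν β J hJ v).trans hv)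
    (finDual_nonneg ν β F w)

/-- The contractive left inverse `K` brings the bound for the image of `v` in `ℒ^β ⊗ F*` back to
`v`; with `K` at hand, no bound on `J` is required. -/
theorem norm_le_of_evaluation_map_le (K : StrongDual 𝕜 F →ₗ[𝕜] Q) (hK : ∀ g, ‖K g‖ ≤ ‖g‖)
    (hKJ : ∀ q, K (J q) = q) {C : ℝ} (hC : 0 ≤ C)
    (h : ∀ w, ‖evaluation β F (TensorProduct.map LinearMap.id J v) w‖ ≤ C * ν.finDual β F w) :
    ν.norm β Q v ≤ C := by
  have h1 := norm_le_of_evaluation_le ν β _ hC h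
  have h2 : TensorProduct.map LinearMap.id K (TensorProduct.map LinearMap.id J v) = v := by
    have : K ∘ₗ J = LinearMap.id := LinearMap.ext hKJ
    rw [← LinearMap.comp_apply, ← TensorProduct.map_comp, this, LinearMap.id_comp,
      TensorProduct.map_id, LinearMap.id_apply]
  rw [← h2]
  exact (norm_map_id_le_of_contraction ν β K hK _).trans h1

end FinDual

/-! ### Finite dimensional subspaces and quotients -/

section Duality

variable {𝕜 : Type} [RCLike 𝕜] {Y : Type u} [NormedAddCommGroup Y] [NormedSpace 𝕜 Y]

theorem finrank_strongDual {V : Type*} [NormedAddCommGroup V] [NormedSpace 𝕜 V]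
    [FiniteDimensional 𝕜 V] : Module.finrank 𝕜 (StrongDual 𝕜 V) = Module.finrank 𝕜 V :=
  (LinearMap.toContinuousLinearMap : (V →ₗ[𝕜] 𝕜) ≃ₗ[𝕜] (V →L[𝕜] 𝕜)).finrank_eq.symm.trans
    Subspace.dual_finrank_eq

/-- The pairing of `Y / L` with functionals vanishing on `L`. -/
theorem exists_quotient_pairing (L : CofinSub 𝕜 Y) (F : FinSub 𝕜 (StrongDual 𝕜 Y))
    (h : ∀ f ∈ F.1, ∀ y ∈ L.1, f y = 0) :
    ∃ J : (Y ⧸ L.1) →ₗ[𝕜] StrongDual 𝕜 F.1, (∀ q, ‖J q‖ ≤ ‖q‖) ∧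
      ∀ y (f : F.1), J (L.1.mkQ y) f = f.1 y := by
  let B : Y →ₗ[𝕜] StrongDual 𝕜 F.1 :=
    (LinearMap.toContinuousLinearMap : (F.1 →ₗ[𝕜] 𝕜) ≃ₗ[𝕜] (F.1 →L[𝕜] 𝕜)).toLinearMap ∘ₗ
      ((ContinuousLinearMap.coeLM 𝕜 : StrongDual 𝕜 Y →ₗ[𝕜] (Y →ₗ[𝕜] 𝕜)) ∘ₗ F.1.subtype).flip
  have hB : L.1 ≤ LinearMap.ker B := fun y hy => by
    rw [LinearMap.mem_ker]
    ext f
    exact h f f.2 y hy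
  have hn : ∀ q, ‖L.1.liftQ B hB q‖ ≤ ‖q‖ := by
    intro q
    refine ContinuousLinearMap.opNorm_le_bound _ (norm_nonneg _) fun f => ?_
    refine le_of_forall_pos_le_add fun ε hε => ?_
    -- The quotient norm is only approximated by representatives; the error is scaled so that it
    -- contributes at most `ε` after multiplication by `‖f‖`.
    obtain ⟨y, rfl, hy⟩ := Submodule.Quotient.norm_mk_lt q
      (show 0 < ε / (‖f‖ + 1) by positivity)
    have h1 : ‖(f : StrongDual 𝕜 Y) y‖ ≤ ‖f‖ * ‖y‖ := f.1.le_opNorm y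
    have h2 : ‖f‖ * (ε / (‖f‖ + 1)) ≤ ε := by
      rw [mul_div_assoc', div_le_iff₀ (by positivity)]
      nlinarith [norm_nonneg f]
    calc _ = ‖(f : StrongDual 𝕜 Y) y‖ := rfl
      _ ≤ ‖f‖ * ‖y‖ := h1
      _ ≤ ‖f‖ * (‖(Submodule.Quotient.mk y : Y ⧸ L.1)‖ + ε / (‖f‖ + 1)) := by gcongr
      _ ≤ _ := by rw [mul_add, mul_comm ‖f‖ ‖_‖]; gcongr
  exact ⟨L.1.liftQ B hB, hn, fun y f => rfl⟩

/-- The common kernel of finitely many functionals. -/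
theorem exists_preannihilator (F : FinSub 𝕜 (StrongDual 𝕜 Y)) :
    ∃ L : CofinSub 𝕜 Y, ∀ f ∈ F.1, ∀ y ∈ L.1, f y = 0 := by
  let B : Y →ₗ[𝕜] F.1 →ₗ[𝕜] 𝕜 :=
    ((ContinuousLinearMap.coeLM 𝕜 : StrongDual 𝕜 Y →ₗ[𝕜] (Y →ₗ[𝕜] 𝕜)) ∘ₗ F.1.subtype).flip
  have hcl : IsClosed (LinearMap.ker B : Set Y) := by
    have : (LinearMap.ker B : Set Y) = ⋂ f : F.1, {y | f.1 y = 0} := by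
      ext y
      simp only [SetLike.mem_coe, LinearMap.mem_ker, Set.mem_iInter, Set.mem_ofPred_eq]
      exact ⟨fun h f => LinearMap.congr_fun h f, fun h => LinearMap.ext h⟩
    rw [this]
    exact isClosed_iInter fun f => isClosed_eq f.1.continuous continuous_const
  -- The codimension is finite because `Y / ker B` is isomorphic to a subspace of the dual of `F`.
  exact ⟨⟨LinearMap.ker B, hcl, Module.Finite.equiv B.quotKerEquivRange.symm⟩,
    fun f hf y hy => LinearMap.congr_fun (LinearMap.mem_ker.1 hy) ⟨f, hf⟩⟩

/-- The annihilator `F` of a closed subspace `L` of finite codimension, with `Y / L = F*`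
isometrically. -/
theorem exists_annihilator (L : CofinSub 𝕜 Y) :
    ∃ (F : FinSub 𝕜 (StrongDual 𝕜 Y)) (J : (Y ⧸ L.1) →ₗ[𝕜] StrongDual 𝕜 F.1)
      (K : StrongDual 𝕜 F.1 →ₗ[𝕜] (Y ⧸ L.1)), (∀ g, ‖K g‖ ≤ ‖g‖) ∧ (∀ q, K (J q) = q) ∧
      ∀ y (f : F.1), J (L.1.mkQ y) f = f.1 y := by
  have := L.2.2
  let D : StrongDual 𝕜 (Y ⧸ L.1) →ₗ[𝕜] StrongDual 𝕜 Y :=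
    ((ContinuousLinearMap.compL 𝕜 Y (Y ⧸ L.1) 𝕜).flip L.1.mkQL : _ →L[𝕜] _)
  let F : FinSub 𝕜 (StrongDual 𝕜 Y) := ⟨LinearMap.range D, inferInstance⟩
  obtain ⟨J, -, hJ⟩ := exists_quotient_pairing L F (by
    rintro _ ⟨g, rfl⟩ y hy
    have : L.1.mkQ y = 0 := (Submodule.Quotient.mk_eq_zero _).2 hy
    change g (L.1.mkQ y) = 0
    rw [this, map_zero])
  -- A norming functional on `Y / L` pulls back to an element of the unit ball of `F`, so `J` does
  -- not decrease norms and its inverse will be a contraction.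
  have hle : ∀ q, ‖q‖ ≤ ‖J q‖ := by
    intro q
    obtain ⟨g, hg, hq⟩ := exists_dual_vector'' 𝕜 q
    obtain ⟨y, rfl⟩ := L.1.mkQ_surjective q
    have hf : ‖(⟨D g, g, rfl⟩ : F.1)‖ ≤ 1 := by
      refine ContinuousLinearMap.opNorm_le_bound _ zero_le_one fun z => ?_
      calc ‖g (L.1.mkQ z)‖ ≤ ‖g‖ * ‖L.1.mkQ z‖ := g.le_opNorm _
        _ ≤ 1 * ‖z‖ := by
          gcongr
          exact Submodule.Quotient.norm_mk_le _ _
    have h1 := (J (L.1.mkQ y)).le_opNorm (⟨D g, g, rfl⟩ : F.1)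
    rw [hJ] at h1
    change ‖g (L.1.mkQ y)‖ ≤ _ at h1
    rw [hq, RCLike.norm_ofReal, abs_norm] at h1
    exact h1.trans (mul_le_of_le_one_right (norm_nonneg _) hf)
  have hinj : Function.Injective J := (injective_iff_map_eq_zero J).2 fun q hq => by
    exact norm_le_zero_iff.1 ((hle q).trans_eq ((congrArg norm hq).trans
      ContinuousLinearMap.opNorm_zero))
  -- Surjectivity of `J` by counting: `F` is the image of `(Y / L)*`, so `F*` is no larger than `Y /
  -- L`.
  have hdim : Module.finrank 𝕜 (Y ⧸ L.1) = Module.finrank 𝕜 (StrongDual 𝕜 F.1) := by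
    refine le_antisymm (LinearMap.finrank_le_finrank_of_injective (f := J) hinj) ?_
    rw [finrank_strongDual, ← finrank_strongDual (V := Y ⧸ L.1)]
    exact LinearMap.finrank_range_le D
  let e := LinearEquiv.ofInjectiveOfFinrankEq J hinj hdim
  have he : ∀ q, e q = J q := fun q => rfl
  refine ⟨F, J, (e.symm : StrongDual 𝕜 F.1 →ₗ[𝕜] (Y ⧸ L.1)), fun z => ?_, fun q => ?_, hJ⟩
  · obtain ⟨q, rfl⟩ := e.surjective z
    rw [LinearEquiv.coe_coe, e.symm_apply_apply]
    exact hle q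
  · exact e.symm_apply_apply q

end Duality

/-! ### Tensors over subspaces: every tensor lives on finite dimensional ones. -/

section Incl

variable {𝕜 : Type} [RCLike 𝕜] {n : ℕ} {X : Fin n → Type u}
  [∀ i, NormedAddCommGroup (X i)] [∀ i, NormedSpace 𝕜 (X i)] {Y : Type u}
  [NormedAddCommGroup Y] [NormedSpace 𝕜 Y] (β : ReasonableCrossnorm 𝕜 X)

@[simp]
theorem incl_tmul (E : ∀ i, FinSub 𝕜 (X i)) (F : FinSub 𝕜 Y) (w : CrossTensor (β.restrict E))
    (f : F.1) : incl β E F (w ⊗ₜ[𝕜] f) = crossIncl β E w ⊗ₜ[𝕜] (f : Y) := rfl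

theorem range_crossIncl_mono {E E' : ∀ i, FinSub 𝕜 (X i)} (h : ∀ i, (E i).1 ≤ (E' i).1) :
    LinearMap.range (crossIncl β E) ≤ LinearMap.range (crossIncl β E') := by
  have : (crossIncl β E) = (crossIncl β E') ∘ₗ
      (PiTensorProduct.map (fun i => Submodule.inclusion (h i)) :
        (⨂[𝕜] i, (E i).1) →ₗ[𝕜] (⨂[𝕜] i, (E' i).1)) := by
    refine crossTensor_ext fun x => ?_
    rw [crossIncl_tensor]
    exact ((congrArg (crossIncl β E')
      (PiTensorProduct.map_tprod (fun i => Submodule.inclusion (h i)) x)).trans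
      (crossIncl_tensor β E' _)).symm
  rw [this]
  exact LinearMap.range_comp_le_range _ _

theorem exists_crossIncl_eq (u : CrossTensor β) :
    ∃ (E : ∀ i, FinSub 𝕜 (X i)) (w : CrossTensor (β.restrict E)), crossIncl β E w = u := by
  have hu : u ∈ Submodule.span 𝕜 (segre β) := by rw [span_segre]; trivial
  induction hu using Submodule.span_induction with
  | zero => exact ⟨fun _ => ⟨⊥, inferInstance⟩, 0, map_zero _⟩
  | mem u hu =>
    obtain ⟨x, rfl⟩ := hu
    exact ⟨fun i => ⟨Submodule.span 𝕜 {x i}, inferInstance⟩,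
      tensor _ fun i => ⟨x i, Submodule.mem_span_singleton_self _⟩, crossIncl_tensor β _ _⟩
  | smul c u _ hu =>
    obtain ⟨E, w, rfl⟩ := hu
    exact ⟨E, c • w, map_smul _ _ _⟩
  | add u v _ _ hu hv =>
    obtain ⟨E, w, rfl⟩ := hu
    obtain ⟨E', w', rfl⟩ := hv
    have := fun i => (E i).2
    have := fun i => (E' i).2
    let G : ∀ i, FinSub 𝕜 (X i) := fun i => ⟨(E i).1 ⊔ (E' i).1, inferInstance⟩
    obtain ⟨a, ha⟩ := range_crossIncl_mono β (E := E) (E' := G) (fun i => le_sup_left) ⟨w, rfl⟩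
    obtain ⟨b, hb⟩ := range_crossIncl_mono β (E := E') (E' := G) (fun i => le_sup_right) ⟨w', rfl⟩
    exact ⟨G, a + b, by rw [map_add, ha, hb]⟩

theorem range_incl_mono {E E' : ∀ i, FinSub 𝕜 (X i)} (h : ∀ i, (E i).1 ≤ (E' i).1)
    {F F' : FinSub 𝕜 Y} (hF : F.1 ≤ F'.1) :
    LinearMap.range (incl β E F) ≤ LinearMap.range (incl β E' F') := by
  rintro _ ⟨w, rfl⟩
  induction w with
  | zero => exact ⟨0, by simp⟩
  | add w w' hw hw' => rw [map_add]; exact Submodule.add_mem _ hw hw'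
  | tmul w f =>
    obtain ⟨a, ha⟩ := range_crossIncl_mono β h ⟨w, rfl⟩
    exact ⟨a ⊗ₜ ⟨f, hF f.2⟩, by rw [incl_tmul, incl_tmul, ha]⟩

theorem exists_incl_eq (u : CrossTensor β ⊗[𝕜] Y) :
    ∃ (E : ∀ i, FinSub 𝕜 (X i)) (F : FinSub 𝕜 Y) (w : CrossTensor (β.restrict E) ⊗[𝕜] F.1),
      incl β E F w = u := by
  induction u with
  | zero => exact ⟨fun _ => ⟨⊥, inferInstance⟩, ⟨⊥, inferInstance⟩, 0, map_zero _⟩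
  | tmul u y =>
    obtain ⟨E, w, rfl⟩ := exists_crossIncl_eq β u
    exact ⟨E, ⟨Submodule.span 𝕜 {y}, inferInstance⟩,
      w ⊗ₜ ⟨y, Submodule.mem_span_singleton_self y⟩, rfl⟩
  | add u v hu hv =>
    obtain ⟨E, F, w, rfl⟩ := hu
    obtain ⟨E', F', w', rfl⟩ := hv
    have := fun i => (E i).2
    have := fun i => (E' i).2
    have := F.2
    have := F'.2
    let G : ∀ i, FinSub 𝕜 (X i) := fun i => ⟨(E i).1 ⊔ (E' i).1, inferInstance⟩
    let H : FinSub 𝕜 Y := ⟨F.1 ⊔ F'.1, inferInstance⟩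
    obtain ⟨a, ha⟩ := range_incl_mono β (E := E) (E' := G) (fun i => le_sup_left)
      (F' := H) le_sup_left ⟨w, rfl⟩
    obtain ⟨b, hb⟩ := range_incl_mono β (E := E') (E' := G) (fun i => le_sup_right)
      (F' := H) le_sup_right ⟨w', rfl⟩
    exact ⟨G, H, a + b, by rw [map_add, ha, hb]⟩

end Incl

/-! ### The finitely generated norm `α^β`. -/

section OnSpaces

variable {𝕜 : Type} [RCLike 𝕜] (ν : SigmaTensorNormOnDuals.{u} 𝕜) {n : ℕ} [NeZero n]
  {X : Fin n → Type u} [∀ i, NormedAddCommGroup (X i)] [∀ i, NormedSpace 𝕜 (X i)]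
  {Y : Type u} [NormedAddCommGroup Y] [NormedSpace 𝕜 Y] [CompleteSpace Y]
  (β : ReasonableCrossnorm 𝕜 X)

theorem onSpaces_nonneg (u : CrossTensor β ⊗[𝕜] Y) : 0 ≤ ν.onSpaces β Y u := by
  refine Real.sInf_nonneg ?_
  rintro _ ⟨E, F, w, -, rfl⟩
  exact finDual_nonneg ν _ _ w

theorem onSpaces_incl_le (E : ∀ i, FinSub 𝕜 (X i)) (F : FinSub 𝕜 Y)
    (w : CrossTensor (β.restrict E) ⊗[𝕜] F.1) :
    ν.onSpaces β Y (incl β E F w) ≤ ν.finDual (β.restrict E) F.1 w := by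
  refine csInf_le ⟨0, ?_⟩ ⟨E, F, w, rfl, rfl⟩
  rintro _ ⟨E, F, w, -, rfl⟩
  exact finDual_nonneg ν _ _ w

/-- A bound against an infimum is a bound against all its competitors; the set of competitors is
nonempty by `exists_incl_eq`. -/
theorem norm_le_onSpaces_iff (φ : Module.Dual 𝕜 (CrossTensor β ⊗[𝕜] Y)) {C : ℝ} (hC : 0 ≤ C) :
    (∀ u, ‖φ u‖ ≤ C * ν.onSpaces β Y u) ↔
      ∀ (E : ∀ i, FinSub 𝕜 (X i)) (F : FinSub 𝕜 Y) (w : CrossTensor (β.restrict E) ⊗[𝕜] F.1),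
        ‖φ (incl β E F w)‖ ≤ C * ν.finDual (β.restrict E) F.1 w := by
  refine ⟨fun h E F w => (h _).trans (by gcongr; exact onSpaces_incl_le ν β E F w),
    fun h u => ?_⟩
  obtain ⟨E, F, w, hw⟩ := exists_incl_eq β u
  have hne : {r : ℝ | ∃ (E : ∀ i, FinSub 𝕜 (X i)) (F : FinSub 𝕜 Y)
      (w : CrossTensor (β.restrict E) ⊗[𝕜] F.1),
      incl β E F w = u ∧ r = ν.finDual (β.restrict E) F.1 w}.Nonempty := ⟨_, E, F, w, hw, rfl⟩
  refine le_of_forall_pos_le_add fun ε hε => ?_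
  -- The denominator `C + 1` also serves the case `C = 0`.
  obtain ⟨_, ⟨E, F, w, rfl, rfl⟩, hr⟩ := Real.lt_sInf_add_pos hne
    (show 0 < ε / (C + 1) by positivity)
  have h2 : C * (ε / (C + 1)) ≤ ε := by
    rw [mul_div_assoc', div_le_iff₀ (by positivity)]
    nlinarith
  calc _ ≤ C * ν.finDual (β.restrict E) F.1 w := h E F w
    _ ≤ C * (ν.onSpaces β Y (incl β E F w) + ε / (C + 1)) :=
      mul_le_mul_of_nonneg_left hr.le hC
    _ ≤ _ := by rw [mul_add]; gcongr

/-- The bound is attained on the spans of the single vectors, where it is axiom (D2) for `p = x₁ ⊗ ⋯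
⊗ xₙ` and `q = 0`. The zero tensor is decomposable because `n ≥ 1`. -/
theorem onSpaces_tensor_tmul_le (x : ∀ i, X i) (y : Y) :
    ν.onSpaces β Y (tensor β x ⊗ₜ[𝕜] y) ≤ ‖y‖ * ∏ i, ‖x i‖ := by
  let E : ∀ i, FinSub 𝕜 (X i) := fun i => ⟨Submodule.span 𝕜 {x i}, inferInstance⟩
  let F : FinSub 𝕜 Y := ⟨Submodule.span 𝕜 {y}, inferInstance⟩
  let x' : ∀ i, (E i).1 := fun i => ⟨x i, Submodule.mem_span_singleton_self _⟩
  let y' : F.1 := ⟨y, Submodule.mem_span_singleton_self _⟩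
  have h := onSpaces_incl_le ν β E F (tensor _ x' ⊗ₜ[𝕜] y')
  rw [incl_tmul, crossIncl_tensor] at h
  refine h.trans (dualNorm_le (by positivity) fun v => ?_)
  have h0 : (0 : CrossTensor (β.restrict E)) ∈ segre (β.restrict E) :=
    ⟨0, (tensor (β.restrict E)).map_zero⟩
  have heq : evaluationAt (tensor (β.restrict E) x') (NormedSpace.inclusionInDoubleDual 𝕜 F.1 y') v
      = (evaluation (β.restrict E) F.1).flip (tensor _ x' ⊗ₜ[𝕜] y') v := by
    induction v with
    | zero => simp
    | add v v' h h' => simp only [map_add, h, h']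
    | tmul φ g => rfl
  have key := ν.evaluation_le (β.restrict E) (StrongDual 𝕜 F.1) _ ⟨x', rfl⟩ _ h0
    (NormedSpace.inclusionInDoubleDual 𝕜 F.1 y') v
  rw [sub_zero] at key
  rw [← heq]
  refine key.trans ?_
  rw [mul_comm ‖tensor _ x'‖]
  gcongr
  · exact NormedSpace.double_dual_bound 𝕜 F.1 y'
  · exact norm_tensor_le (β.restrict E) x'

end OnSpaces

/-! ### Functionals defined by operators. -/

section Forms

variable {𝕜 : Type} [RCLike 𝕜] {n : ℕ} {X : Fin n → Type u}
  [∀ i, NormedAddCommGroup (X i)] [∀ i, NormedSpace 𝕜 (X i)] {Y : Type u}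
  [NormedAddCommGroup Y] [NormedSpace 𝕜 Y] (β : ReasonableCrossnorm 𝕜 X)

/-- The functional on `X₁ ⊗ ⋯ ⊗ Xₙ ⊗ Y*` given by an operator with values in `Y`. -/
noncomputable def operatorForm : ContinuousMultilinearMap 𝕜 X Y →ₗ[𝕜]
    Module.Dual 𝕜 (CrossTensor β ⊗[𝕜] StrongDual 𝕜 Y) where
  toFun T := TensorProduct.lift
    ((ContinuousLinearMap.coeLM 𝕜 : StrongDual 𝕜 Y →ₗ[𝕜] (Y →ₗ[𝕜] 𝕜)).flip ∘ₗ linearization β T)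
  map_add' S T := crossTensor_tmul_ext fun x g => by simp
  map_smul' c T := crossTensor_tmul_ext fun x g => by simp

/-- The functional on `X₁ ⊗ ⋯ ⊗ Xₙ ⊗ Y` given by an operator with values in `Y*`. -/
noncomputable def dualOperatorForm : ContinuousMultilinearMap 𝕜 X (StrongDual 𝕜 Y) →ₗ[𝕜]
    Module.Dual 𝕜 (CrossTensor β ⊗[𝕜] Y) where
  toFun T := TensorProduct.lift
    ((ContinuousLinearMap.coeLM 𝕜 : StrongDual 𝕜 Y →ₗ[𝕜] (Y →ₗ[𝕜] 𝕜)) ∘ₗ linearization β T)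
  map_add' S T := crossTensor_tmul_ext fun x g => by simp
  map_smul' c T := crossTensor_tmul_ext fun x g => by simp

theorem operatorForm_tmul (T : ContinuousMultilinearMap 𝕜 X Y) (w : CrossTensor β)
    (g : StrongDual 𝕜 Y) : operatorForm β T (w ⊗ₜ[𝕜] g) = g (linearization β T w) := rfl

theorem dualOperatorForm_tmul (T : ContinuousMultilinearMap 𝕜 X (StrongDual 𝕜 Y))
    (w : CrossTensor β) (y : Y) :
    dualOperatorForm β T (w ⊗ₜ[𝕜] y) = linearization β T w y := rfl

/-- On `x ⊗ f` both sides are `f (T x)`: the pairing `J` recovers the action of `f` on `T x` from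
its class modulo `L`. -/
theorem operatorForm_incl (T : ContinuousMultilinearMap 𝕜 X Y) (E : ∀ i, FinSub 𝕜 (X i))
    (L : CofinSub 𝕜 Y) (F : FinSub 𝕜 (StrongDual 𝕜 Y)) (J : (Y ⧸ L.1) →ₗ[𝕜] StrongDual 𝕜 F.1)
    (hJ : ∀ y (f : F.1), J (L.1.mkQ y) f = f.1 y) (v : Forms (β.restrict E) ⊗[𝕜] (Y ⧸ L.1))
    (hv : toOperator (β.restrict E) (Y ⧸ L.1) v = localOperator T E L)
    (w : CrossTensor (β.restrict E) ⊗[𝕜] F.1) :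
    operatorForm β T (incl β E F w) =
      evaluation (β.restrict E) F.1 (TensorProduct.map LinearMap.id J v) w := by
  have key : operatorForm β T ∘ₗ incl β E F =
      evaluation (β.restrict E) F.1 (TensorProduct.map LinearMap.id J v) := by
    refine crossTensor_tmul_ext fun x f => ?_
    have h1 : evaluation (β.restrict E) F.1 (TensorProduct.map LinearMap.id J v)
        (tensor (β.restrict E) x ⊗ₜ[𝕜] f) = J (toOperator (β.restrict E) (Y ⧸ L.1) v x) f := by
      clear hv
      induction v with
      | zero => simp
      | add v v' h h' =>
        simp only [map_add, LinearMap.add_apply, h, h', add_apply]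
      | tmul φ q => simp
    rw [h1, hv, LinearMap.comp_apply, incl_tmul, crossIncl_tensor, operatorForm_tmul,
      linearization_tensor]
    exact (hJ _ f).symm
  exact LinearMap.congr_fun key w

end Forms

/-! ### Ideal norms as dual norms, and the passage from `Y**` to `Y`. -/

section Representation

variable {𝕜 : Type} [RCLike 𝕜] {ν : SigmaTensorNormOnDuals.{u} 𝕜} {A : SigmaIdeal.{u} 𝕜}
  {n : ℕ} [NeZero n] {X : Fin n → Type u} [∀ i, NormedAddCommGroup (X i)]
  [∀ i, NormedSpace 𝕜 (X i)] [∀ i, CompleteSpace (X i)]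

theorem extNorm_toOperator (hass : A.IsAssociated ν) [∀ i, FiniteDimensional 𝕜 (X i)]
    (β : ReasonableCrossnorm 𝕜 X) {F : Type u} [NormedAddCommGroup F] [NormedSpace 𝕜 F]
    [CompleteSpace F] [FiniteDimensional 𝕜 F] (v : Forms β ⊗[𝕜] F) :
    A.extNorm β (toOperator β F v) = ENNReal.ofReal (ν.norm β F v) := by
  obtain ⟨Φ, hΦ⟩ := hass β F
  obtain ⟨h1, h2⟩ := hΦ v
  rw [← h1, ← h2, SigmaIdeal.extNorm, dif_pos (Φ v).2]

variable {Y : Type u} [NormedAddCommGroup Y] [NormedSpace 𝕜 Y] [CompleteSpace Y]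

/-- Membership and norm bound become a single inequality in `ℝ≥0∞`, the form in which maximality is
stated. -/
theorem extNorm_le_ofReal_iff (β : ReasonableCrossnorm 𝕜 X) (T : ContinuousMultilinearMap 𝕜 X Y)
    {C : ℝ} (hC : 0 ≤ C) :
    A.extNorm β T ≤ ENNReal.ofReal C ↔ ∃ h : T ∈ A.component β Y, A.idealNorm β Y ⟨T, h⟩ ≤ C := by
  unfold SigmaIdeal.extNorm
  split_ifs with h
  · rw [ENNReal.ofReal_le_ofReal_iff hC]
    exact ⟨fun k => ⟨h, k⟩, fun ⟨_, k⟩ => k⟩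
  · simp [h]

/-- The operators of the maximal ideal in terms of the functionals which they define. -/
theorem idealNorm_le_iff_operatorForm (hmax : A.IsMaximal) (hass : A.IsAssociated ν)
    (β : ReasonableCrossnorm 𝕜 X) (T : ContinuousMultilinearMap 𝕜 X Y) {C : ℝ} (hC : 0 ≤ C) :
    (∃ h : T ∈ A.component β Y, A.idealNorm β Y ⟨T, h⟩ ≤ C) ↔
      ∀ u, ‖operatorForm β T u‖ ≤ C * ν.onSpaces β (StrongDual 𝕜 Y) u := by
  rw [← extNorm_le_ofReal_iff β T hC, hmax β Y T, norm_le_onSpaces_iff ν β _ hC]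
  simp only [iSup_le_iff]
  -- The subspaces `E` are common to both sides; only `L ⊂ Y` and `F ⊂ Y*` have to be exchanged.
  refine forall_congr' fun E => ⟨fun h F w => ?_, fun h L => ?_⟩
  -- For given `F` a contraction `Y / L → F*` suffices, since a bound for `ν` on `Y / L` is carried
  -- forward.
  · obtain ⟨L, hL⟩ := exists_preannihilator F
    have := L.2.2
    obtain ⟨J, hJ, hJf⟩ := exists_quotient_pairing L F hL
    obtain ⟨v, hv⟩ := toOperator_surjective (β.restrict E) (Y ⧸ L.1) (localOperator T E L)
    have h1 := h L
    rw [← hv, extNorm_toOperator hass, ENNReal.ofReal_le_ofReal_iff hC] at h1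
    rw [operatorForm_incl β T E L F J hJf v hv]
    exact norm_evaluation_map_le ν _ J v hJ h1 w
  -- For given `L` the bound must be carried back from `F*` to `Y / L`, which the contraction `K`
  -- does.
  · obtain ⟨F, J, K, hK, hKJ, hJf⟩ := exists_annihilator L
    have := L.2.2
    obtain ⟨v, hv⟩ := toOperator_surjective (β.restrict E) (Y ⧸ L.1) (localOperator T E L)
    rw [← hv, extNorm_toOperator hass, ENNReal.ofReal_le_ofReal_iff hC]
    refine norm_le_of_evaluation_map_le ν _ J v K hK hKJ hC fun w => ?_
    rw [← operatorForm_incl β T E L F J hJf v hv]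
    exact h F w

omit [∀ i, CompleteSpace (X i)] [CompleteSpace Y] in
/-- A bound for a functional on `E₁ ⊗ ⋯ ⊗ Eₙ ⊗ F` which factors through a finite dimensional
subspace of `Y`. -/
theorem norm_le_of_factorization (β : ReasonableCrossnorm 𝕜 X) {E : ∀ i, FinSub 𝕜 (X i)}
    {F : Type u} [NormedAddCommGroup F] [NormedSpace 𝕜 F] [CompleteSpace F]
    [FiniteDimensional 𝕜 F] (φ : Module.Dual 𝕜 (CrossTensor (β.restrict E) ⊗[𝕜] F))
    (ψ : Module.Dual 𝕜 (CrossTensor β ⊗[𝕜] Y)) (R : F →ₗ[𝕜] Y) {c : ℝ} (hc : 0 ≤ c)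
    (hR : ∀ f, ‖R f‖ ≤ c * ‖f‖) (hφ : ∀ w f, φ (w ⊗ₜ[𝕜] f) = ψ (crossIncl β E w ⊗ₜ[𝕜] R f))
    {C : ℝ} (hC : 0 ≤ C)
    (h : ∀ (G : FinSub 𝕜 Y) (w : CrossTensor (β.restrict E) ⊗[𝕜] G.1),
      ‖ψ (incl β E G w)‖ ≤ C * ν.finDual (β.restrict E) G.1 w)
    (w : CrossTensor (β.restrict E) ⊗[𝕜] F) :
    ‖φ w‖ ≤ C * ν.finDual (β.restrict E) F w * c := by
  -- The range of `R` is a finite dimensional subspace on which `h` applies; the metric mapping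
  -- property gives the factor `c`.
  let G : FinSub 𝕜 Y := ⟨LinearMap.range R, inferInstance⟩
  let B : F →ₗ[𝕜] G.1 := R.rangeRestrict
  have key : φ w = ψ (incl β E G (TensorProduct.map LinearMap.id B w)) := by
    induction w with
    | zero => simp
    | add w w' h h' => simp only [map_add, h, h']
    | tmul w f => exact hφ w f
  rw [key, mul_assoc]
  refine (h G _).trans (mul_le_mul_of_nonneg_left ?_ hC)
  exact (finDual_map_le ν _ B hc hR w).trans_eq (mul_comm _ _)

-- Here local reflexivity enters. For a fixed tensor `w = ∑ eᵢ ⊗ fᵢ`, factorization through finite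
-- dimensional subspaces of `Y` bounds `∑ T(eᵢ)(R fᵢ)` by a multiple of `‖R‖` for every `R : F → Y`,
-- and `norm_sum_bidual_le` extends the bound to the contraction `S` into the bidual.
omit [∀ i, CompleteSpace (X i)] [CompleteSpace Y] in
theorem norm_operatorForm_map_le (β : ReasonableCrossnorm 𝕜 X)
    (T : ContinuousMultilinearMap 𝕜 X (StrongDual 𝕜 Y)) {E : ∀ i, FinSub 𝕜 (X i)} {C : ℝ}
    (hC : 0 ≤ C) (h : ∀ (G : FinSub 𝕜 Y) (w : CrossTensor (β.restrict E) ⊗[𝕜] G.1),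
      ‖dualOperatorForm β T (incl β E G w)‖ ≤ C * ν.finDual (β.restrict E) G.1 w)
    {F : Type u} [NormedAddCommGroup F] [NormedSpace 𝕜 F] [CompleteSpace F]
    [FiniteDimensional 𝕜 F] (S : F →ₗ[𝕜] StrongDual 𝕜 (StrongDual 𝕜 Y)) (hS : ∀ f, ‖S f‖ ≤ ‖f‖)
    (w : CrossTensor (β.restrict E) ⊗[𝕜] F) :
    ‖operatorForm β T (TensorProduct.map (crossIncl β E) S w)‖ ≤
      C * ν.finDual (β.restrict E) F w := by
  obtain ⟨s, rfl⟩ := TensorProduct.exists_finset w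
  have key : ∀ R : F →L[𝕜] Y,
      ‖∑ p ∈ s, linearization β T (crossIncl β E p.1) (R p.2)‖ ≤
        C * ν.finDual (β.restrict E) F (∑ p ∈ s, p.1 ⊗ₜ[𝕜] p.2) * ‖R‖ := by
    intro R
    have h1 := norm_le_of_factorization β
      (dualOperatorForm β T ∘ₗ TensorProduct.map (crossIncl β E) (R : F →ₗ[𝕜] Y))
      (dualOperatorForm β T) R (norm_nonneg R) R.le_opNorm (fun w f => rfl) hC h
      (∑ p ∈ s, p.1 ⊗ₜ[𝕜] p.2)
    rw [map_sum] at h1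
    exact h1
  have h2 := norm_sum_bidual_le s (fun p => p.2)
    (fun p => linearization β T (crossIncl β E p.1))
    (mul_nonneg hC (finDual_nonneg ν _ _ _)) key S hS
  rw [map_sum, map_sum]
  exact h2

/-- By local reflexivity, the functionals on `X₁ ⊗ ⋯ ⊗ Xₙ ⊗ Y` and on `X₁ ⊗ ⋯ ⊗ Xₙ ⊗ Y**`
which are given by an operator with values in `Y*` have the same bounds. -/
theorem norm_operatorForm_le_iff (β : ReasonableCrossnorm 𝕜 X)
    (T : ContinuousMultilinearMap 𝕜 X (StrongDual 𝕜 Y)) {C : ℝ} (hC : 0 ≤ C) :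
    (∀ u, ‖operatorForm β T u‖ ≤ C * ν.onSpaces β (StrongDual 𝕜 (StrongDual 𝕜 Y)) u) ↔
      ∀ u, ‖dualOperatorForm β T u‖ ≤ C * ν.onSpaces β Y u := by
  rw [norm_le_onSpaces_iff ν β _ hC, norm_le_onSpaces_iff ν β _ hC]
  refine forall_congr' fun E => ⟨fun h F w => ?_, fun h F w =>
    norm_operatorForm_map_le β T hC h F.1.subtype (fun f => le_rfl) w⟩
  -- The embedding of `Y` into its bidual is a contraction, hence the constant `1`. The other
  -- direction has been settled by taking for `S` the inclusion of `F` into `Y**`.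
  have h1 := norm_le_of_factorization β (dualOperatorForm β T ∘ₗ incl β E F) (operatorForm β T)
    ((NormedSpace.inclusionInDoubleDual 𝕜 Y : Y →ₗ[𝕜] _) ∘ₗ F.1.subtype) zero_le_one
    (fun f => by rw [one_mul]; exact NormedSpace.double_dual_bound 𝕜 Y f) (fun w f => rfl) hC h w
  rw [mul_one] at h1
  exact h1

omit [∀ i, CompleteSpace (X i)] in
/-- The multilinear operator defined by a bounded functional. -/
theorem exists_dualOperatorForm_eq (ν : SigmaTensorNormOnDuals.{u} 𝕜)
    (β : ReasonableCrossnorm 𝕜 X) (φ : Module.Dual 𝕜 (CrossTensor β ⊗[𝕜] Y))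
    (hφ : φ ∈ boundedDual (𝕜 := 𝕜) (ν.onSpaces β Y)) :
    ∃ T : ContinuousMultilinearMap 𝕜 X (StrongDual 𝕜 Y), dualOperatorForm β T = φ := by
  obtain ⟨C, hC, h⟩ := hφ
  have hb : ∀ x y, ‖φ (tensor β x ⊗ₜ[𝕜] y)‖ ≤ C * (∏ i, ‖x i‖) * ‖y‖ := fun x y => by
    refine (h _).trans ?_
    rw [mul_assoc, mul_comm (∏ i, ‖x i‖)]
    gcongr
    exact onSpaces_tensor_tmul_le ν β x y
  let M : MultilinearMap 𝕜 X (StrongDual 𝕜 Y) :=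
    { toFun x := ((TensorProduct.curry φ) (tensor β x)).mkContinuous (C * ∏ i, ‖x i‖) (hb x)
      map_update_add' x i a b := by
        ext y
        change φ (_ ⊗ₜ y) = φ (_ ⊗ₜ y) + φ (_ ⊗ₜ y)
        rw [ContinuousMultilinearMap.map_update_add, TensorProduct.add_tmul, map_add]
      map_update_smul' x i c a := by
        ext y
        change φ (_ ⊗ₜ y) = c • φ (_ ⊗ₜ y)
        rw [ContinuousMultilinearMap.map_update_smul, ← TensorProduct.smul_tmul', map_smul] }
  refine ⟨M.mkContinuous C fun x => LinearMap.mkContinuous_norm_le _ (by positivity) (hb x), ?_⟩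
  refine crossTensor_tmul_ext fun x y => ?_
  rw [dualOperatorForm_tmul, linearization_tensor]
  rfl

theorem mem_component_iff_operatorForm (hmax : A.IsMaximal) (hass : A.IsAssociated ν)
    (β : ReasonableCrossnorm 𝕜 X) (T : ContinuousMultilinearMap 𝕜 X Y) :
    T ∈ A.component β Y ↔
      operatorForm β T ∈ boundedDual (𝕜 := 𝕜) (ν.onSpaces β (StrongDual 𝕜 Y)) :=
  ⟨fun h => ⟨_, apply_nonneg _ _,
      (idealNorm_le_iff_operatorForm hmax hass β T (apply_nonneg _ _)).1 ⟨h, le_rfl⟩⟩,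
    fun ⟨_, hC, h⟩ => ((idealNorm_le_iff_operatorForm hmax hass β T hC).2 h).1⟩

theorem idealNorm_le_iff_dualOperatorForm (hmax : A.IsMaximal) (hass : A.IsAssociated ν)
    (β : ReasonableCrossnorm 𝕜 X) (T : ContinuousMultilinearMap 𝕜 X (StrongDual 𝕜 Y)) {C : ℝ}
    (hC : 0 ≤ C) :
    (∃ h : T ∈ A.component β (StrongDual 𝕜 Y), A.idealNorm β (StrongDual 𝕜 Y) ⟨T, h⟩ ≤ C) ↔
      ∀ u, ‖dualOperatorForm β T u‖ ≤ C * ν.onSpaces β Y u :=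
  (idealNorm_le_iff_operatorForm hmax hass β T hC).trans (norm_operatorForm_le_iff β T hC)

theorem mem_component_iff_dualOperatorForm (hmax : A.IsMaximal) (hass : A.IsAssociated ν)
    (β : ReasonableCrossnorm 𝕜 X) (T : ContinuousMultilinearMap 𝕜 X (StrongDual 𝕜 Y)) :
    T ∈ A.component β (StrongDual 𝕜 Y) ↔
      dualOperatorForm β T ∈ boundedDual (𝕜 := 𝕜) (ν.onSpaces β Y) :=
  ⟨fun h => ⟨_, apply_nonneg _ _,
      (idealNorm_le_iff_dualOperatorForm hmax hass β T (apply_nonneg _ _)).1 ⟨h, le_rfl⟩⟩,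
    fun ⟨_, hC, h⟩ => ((idealNorm_le_iff_dualOperatorForm hmax hass β T hC).2 h).1⟩

theorem dualNorm_operatorForm (hmax : A.IsMaximal) (hass : A.IsAssociated ν)
    (β : ReasonableCrossnorm 𝕜 X) (T : A.component β Y) :
    dualNorm (ν.onSpaces β (StrongDual 𝕜 Y)) (operatorForm β T.1) = A.idealNorm β Y T := by
  refine le_antisymm (dualNorm_le (apply_nonneg _ _)
    ((idealNorm_le_iff_operatorForm hmax hass β T.1 (apply_nonneg _ _)).1 ⟨T.2, le_rfl⟩)) ?_
  exact ((idealNorm_le_iff_operatorForm hmax hass β T.1 (dualNorm_nonneg _ _)).2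
    (norm_le_dualNorm_mul (onSpaces_nonneg ν β)
      ((mem_component_iff_operatorForm hmax hass β T.1).1 T.2))).2

theorem dualNorm_dualOperatorForm (hmax : A.IsMaximal) (hass : A.IsAssociated ν)
    (β : ReasonableCrossnorm 𝕜 X) (T : A.component β (StrongDual 𝕜 Y)) :
    dualNorm (ν.onSpaces β Y) (dualOperatorForm β T.1) = A.idealNorm β (StrongDual 𝕜 Y) T := by
  refine le_antisymm (dualNorm_le (apply_nonneg _ _)
    ((idealNorm_le_iff_dualOperatorForm hmax hass β T.1 (apply_nonneg _ _)).1 ⟨T.2, le_rfl⟩)) ?_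
  exact ((idealNorm_le_iff_dualOperatorForm hmax hass β T.1 (dualNorm_nonneg _ _)).2
    (norm_le_dualNorm_mul (onSpaces_nonneg ν β)
      ((mem_component_iff_dualOperatorForm hmax hass β T.1).1 T.2))).2

end Representation

end SigmaIdeals

/-! ### The representation theorem. -/

theorem theorem5 {𝕜 : Type} [RCLike 𝕜]
    (ν : SigmaTensorNormOnDuals.{u} 𝕜) (A : SigmaIdeal.{u} 𝕜)
    (hmax : A.IsMaximal) (hass : A.IsAssociated ν)
    {n : ℕ} [NeZero n] {X : Fin n → Type u} [∀ i, NormedAddCommGroup (X i)]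
    [∀ i, NormedSpace 𝕜 (X i)] [∀ i, CompleteSpace (X i)]
    {Y : Type u} [NormedAddCommGroup Y] [NormedSpace 𝕜 Y] [CompleteSpace Y]
    (β : ReasonableCrossnorm 𝕜 X) :
    (∃ Φ : boundedDual (𝕜 := 𝕜) (ν.onSpaces β Y) ≃ₗ[𝕜] A.component β (StrongDual 𝕜 Y),
      (∀ φ x y, (Φ φ : ContinuousMultilinearMap 𝕜 X (StrongDual 𝕜 Y)) x y =
        φ.1 (tensor β x ⊗ₜ[𝕜] y)) ∧
      ∀ φ, A.idealNorm β (StrongDual 𝕜 Y) (Φ φ) = dualNorm (ν.onSpaces β Y) φ.1) ∧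
    (∃ Ψ : dualInterOperators β Y (ν.onSpaces β (StrongDual 𝕜 Y)) ≃ₗ[𝕜] A.component β Y,
      (∀ φ x (g : StrongDual 𝕜 Y), g ((Ψ φ : ContinuousMultilinearMap 𝕜 X Y) x) =
        φ.1 (tensor β x ⊗ₜ[𝕜] g)) ∧
      ∀ φ, A.idealNorm β Y (Ψ φ) = dualNorm (ν.onSpaces β (StrongDual 𝕜 Y)) φ.1) := by
  constructor
  -- The map from operators to functionals is explicit and linear, so it is built and then inverted.
  · let f : A.component β (StrongDual 𝕜 Y) →ₗ[𝕜] boundedDual (𝕜 := 𝕜) (ν.onSpaces β Y) :=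
      ((dualOperatorForm β).comp (A.component β (StrongDual 𝕜 Y)).subtype).codRestrict _
        fun T => (mem_component_iff_dualOperatorForm hmax hass β T.1).1 T.2
    have hf : ∀ T x y, (f T).1 (tensor β x ⊗ₜ[𝕜] y) = T.1 x y := fun T x y => by
      change dualOperatorForm β T.1 _ = _
      rw [dualOperatorForm_tmul, linearization_tensor]
    have hbij : Function.Bijective f := by
      refine ⟨fun S T h => ?_, fun φ => ?_⟩
      · ext x y
        rw [← hf, ← hf, h]
      · obtain ⟨T, hT⟩ := exists_dualOperatorForm_eq ν β φ.1 φ.2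
        exact ⟨⟨T, (mem_component_iff_dualOperatorForm hmax hass β T).2 (hT ▸ φ.2)⟩,
          Subtype.ext hT⟩
    refine ⟨(LinearEquiv.ofBijective f hbij).symm, fun φ x y => ?_, fun φ => ?_⟩
    · obtain ⟨T, rfl⟩ := (LinearEquiv.ofBijective f hbij).surjective φ
      rw [LinearEquiv.symm_apply_apply]
      exact (hf T x y).symm
    · obtain ⟨T, rfl⟩ := (LinearEquiv.ofBijective f hbij).surjective φ
      rw [LinearEquiv.symm_apply_apply]
      exact (dualNorm_dualOperatorForm hmax hass β T).symm
  · have hmem : ∀ T : A.component β Y, operatorForm β T.1 ∈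
        dualInterOperators β Y (ν.onSpaces β (StrongDual 𝕜 Y)) := fun T =>
      ⟨(mem_component_iff_operatorForm hmax hass β T.1).1 T.2, T.1, fun x g => by
        rw [operatorForm_tmul, linearization_tensor]⟩
    let f : A.component β Y →ₗ[𝕜] dualInterOperators β Y (ν.onSpaces β (StrongDual 𝕜 Y)) :=
      ((operatorForm β).comp (A.component β Y).subtype).codRestrict _ hmem
    have hf : ∀ T x g, (f T).1 (tensor β x ⊗ₜ[𝕜] g) = g (T.1 x) := fun T x y => by
      change operatorForm β T.1 _ = _
      rw [operatorForm_tmul, linearization_tensor]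
    have hbij : Function.Bijective f := by
      refine ⟨fun S T h => ?_, fun φ => ?_⟩
      · ext x
        -- Only the pairings with `Y*` are known, and these separate the points of `Y`.
        refine (SeparatingDual.eq_iff_forall_dual_eq (R := 𝕜)).2 fun g => ?_
        rw [← hf, ← hf, h]
      · obtain ⟨φ, hφ, T, hT⟩ := φ
        -- The operator is part of the data of the intersection; without it a bounded functional
        -- would only give values in `Y**`.
        obtain rfl : operatorForm β T = φ := crossTensor_tmul_ext fun x g => by
          rw [hT, operatorForm_tmul, linearization_tensor]
        exact ⟨⟨T, (mem_component_iff_operatorForm hmax hass β T).2 hφ⟩, rfl⟩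
    refine ⟨(LinearEquiv.ofBijective f hbij).symm, fun φ x y => ?_, fun φ => ?_⟩
    · obtain ⟨T, rfl⟩ := (LinearEquiv.ofBijective f hbij).surjective φ
      rw [LinearEquiv.symm_apply_apply]
      exact (hf T x y).symm
    · obtain ⟨T, rfl⟩ := (LinearEquiv.ofBijective f hbij).surjective φ
      rw [LinearEquiv.symm_apply_apply]
      exact (dualNorm_operatorForm hmax hass β T).symm
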